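/- The unbiased (1:1) Walker-Breaker game on the complete graph $K_n$ is played as follows. Walker stands at a start vertex $v_0$, which both players know before the first move, and no edge is claimed. The two players alternate. In her turn, Walker, standing at a vertex $v$, chooses an edge $vw$ of $K_n$ that Breaker has not claimed (she may have claimed it earlier herself), claims it if it is not yet hers, and moves to $w$. In his turn, Breaker claims one edge of $K_n$ that neither player has claimed. A player who has no legal move passes. **Theorem 1.1.** There is an integer $n_0$ such that for every $n \ge n_0$ and every start vertex $v_0$ of $K_n$ the following holds. 1. No matter which of the players moves first, Walker has a strategy which, against every play of Breaker, ensures that after finitely many moves the graph formed by Walker's edges contains a cycle of length $n-2$. 2. If Breaker moves first, he has a strategy which, against every play of Walker, ensures that at no time the graph formed by Walker's edges contains a cycle of length greater than $n-2$. -/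

import Mathlib

namespace WalkerBreaker

/-- The two players. -/
inductive Player where
  | walker
  | breaker

/-- The opponent of a player. -/
def Player.other : Player → Player
  | .walker => .breaker
  | .breaker => .walker

/-- A state of the game on `K_n`, whose vertex set is `Fin n`: Walker's current position, and the
sets of edges claimed so far by Walker and by Breaker. -/
structure State (n : ℕ) where
  pos : Fin n
  walkerEdges : Finset (Sym2 (Fin n))
  breakerEdges : Finset (Sym2 (Fin n))

variable {n : ℕ}

/-- The initial state: Walker stands at `v` and no edge has been claimed. -/
def State.init (v : Fin n) : State n := ⟨v, ∅, ∅⟩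

/-- The edge `e` of `K_n` has been claimed by neither player. -/
def State.IsFree (s : State n) (e : Sym2 (Fin n)) : Prop :=
  e ∈ (⊤ : SimpleGraph (Fin n)).edgeSet ∧ e ∉ s.walkerEdges ∧ e ∉ s.breakerEdges

/-- Walker may walk to `w`: it is joined to her position by an edge of `K_n` which Breaker has not
claimed (she may have claimed it earlier herself). -/
def State.CanWalkTo (s : State n) (w : Fin n) : Prop :=
  s.pos ≠ w ∧ s(s.pos, w) ∉ s.breakerEdges

/-- Walker walks to `w`, claiming the edge that she uses if it is not yet hers. -/
def State.walkTo (s : State n) (w : Fin n) : State n :=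
  ⟨w, insert s(s.pos, w) s.walkerEdges, s.breakerEdges⟩

/-- Breaker claims the edge `e`. -/
def State.breakerClaim (s : State n) (e : Sym2 (Fin n)) : State n :=
  ⟨s.pos, s.walkerEdges, insert e s.breakerEdges⟩

/-- A legal turn of the given player leads from `s` to `t`. A player must move if this is possible,
and passes otherwise. -/
def LegalTurn : Player → State n → State n → Prop
  | .walker, s, t => (∃ w, s.CanWalkTo w ∧ t = s.walkTo w) ∨ ((∀ w, ¬ s.CanWalkTo w) ∧ t = s)
  | .breaker, s, t => (∃ e, s.IsFree e ∧ t = s.breakerClaim e) ∨ ((∀ e, ¬ s.IsFree e) ∧ t = s)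

/-- The player whose turn it is after `k` turns, when `first` has the first turn. -/
def mover (first : Player) (k : ℕ) : Player := if Even k then first else first.other

/-- The sequence of states `p` is a play of the `(1:1)` game on `K_n` in which Walker starts at `v`
and `first` has the first turn. The state after `k` turns is `p k`; play never stops, although no
further edges are claimed once there is no free edge left. -/
def IsPlay (first : Player) (v : Fin n) (p : ℕ → State n) : Prop :=
  p 0 = State.init v ∧ ∀ k, LegalTurn (mover first k) (p k) (p (k + 1))

/-- A strategy of a player: given the list of all past states, in chronological order, and the
current state, it prescribes a legal turn. -/
structure Strategy (n : ℕ) (P : Player) where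
  next : List (State n) → State n → State n
  legal : ∀ past s, LegalTurn P s (next past s)

/-- In the play `p`, player `P` follows the strategy `σ` at each of their turns. -/
def Strategy.FollowedIn {P : Player} (σ : Strategy n P) (first : Player) (p : ℕ → State n) : Prop :=
  ∀ k, mover first k = P → p (k + 1) = σ.next ((List.range k).map p) (p k)

/-- The graph formed by Walker's edges. -/
def State.walkerGraph (s : State n) : SimpleGraph (Fin n) :=
  SimpleGraph.fromEdgeSet (s.walkerEdges : Set (Sym2 (Fin n)))

/-- Walker's graph contains a cycle of length `ℓ`. -/
def State.HasWalkerCycle (s : State n) (ℓ : ℕ) : Prop :=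
  ∃ (u : Fin n) (c : s.walkerGraph.Walk u u), c.IsCycle ∧ c.length = ℓ

/-- Walker has a strategy which, against every play of Breaker, creates a cycle of length `ℓ`
after finitely many turns. -/
def WalkerCanCreateCycle (first : Player) (v : Fin n) (ℓ : ℕ) : Prop :=
  ∃ σ : Strategy n .walker, ∀ p : ℕ → State n,
    IsPlay first v p → σ.FollowedIn first p → ∃ k, (p k).HasWalkerCycle ℓ

/-- Breaker has a strategy which, against every play of Walker, ensures that Walker never has a
cycle of length greater than `ℓ`. -/
def BreakerCanPreventLongerCycles (first : Player) (v : Fin n) (ℓ : ℕ) : Prop :=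
  ∃ τ : Strategy n .breaker, ∀ p : ℕ → State n,
    IsPlay first v p → τ.FollowedIn first p → ∀ k m, ℓ < m → ¬ (p k).HasWalkerCycle m

end WalkerBreaker

/-!
Walker's strategy. Suppose that Walker owns a cycle and stands on it at `v`, whose neighbours on the
cycle are `a` and `b`. If she makes a detour from `v` through vertices off the cycle and arrives at
an end from which the edges to both `a` and `b` are not Breaker's, then he can claim only one of
them, and she closes the detour with the other one: the detour is inserted between `v` and `a` or
between `v` and `b` (`State.OnDetour.exists_close`). She first makes a cycle of small linear length
(`force_first_tour`), then enlarges it by long detours (`State.Growing.step`), and in the end by one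
vertex at a time (`State.Finishing.step`).

A single insertion needs two vertices `x` and `y` off the cycle of low degree in Breaker's graph.
Then there is a `v` on the cycle such that `v`, `a` and `b` are joined to neither by Breaker; Walker
moves to `v`, Breaker can spoil only one of `x` and `y`, and she inserts the other. This works until
two vertices are left, provided that at most one vertex off the cycle has high degree. The long
detours ensure this (`force_pursuit`): as soon as an unvisited vertex `u` has high degree, Walker
only visits vertices not joined to `u` by Breaker, so that after each of her moves he has to claim
the edge between her position and `u`, or else she walks to `u`. Hence he cannot raise the degree of
another unvisited vertex while `u` remains unvisited. Few vertices can ever have high degree,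
because Breaker has only linearly many edges. Here `k` is about `n / 10 ^ 6`, and all linear quantities are
multiples of `k`.

Breaker's strategy. He fixes a vertex `u` different from the start vertex, and claims the edge from
Walker's position to `u` after each of her moves, until a single vertex `c` besides `u` is unvisited.
At this time all edges from `u` to visited vertices are his, except the one at Walker's position `b`.
From then on he claims the edge from her position to `c`. So `c` is never visited, and `u` has at most
the one neighbour `b` in her graph: neither is on a cycle (`Isolating.not_hasWalkerCycle`).
-/

namespace WalkerBreaker

variable {n : ℕ}

/-! ### Forcing and strategies -/

/-- With Walker to move in `s`, she can force a state satisfying `P`, with her to move again, within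
`j` rounds. -/
def ForceWithin (P : State n → Prop) : ℕ → State n → Prop
  | 0, s => P s
  | j + 1, s => P s ∨
      ∃ w, s.CanWalkTo w ∧ ∀ t, LegalTurn .breaker (s.walkTo w) t → ForceWithin P j t

/-- With Walker to move in `s`, she can force a state satisfying `P`, with her to move again, after
finitely many rounds. -/
def Force (P : State n → Prop) (s : State n) : Prop := ∃ j, ForceWithin P j s

lemma ForceWithin.of_goal {P : State n → Prop} {s : State n} (h : P s) : ∀ j, ForceWithin P j s
  | 0 => h
  | _ + 1 => Or.inl h

lemma ForceWithin.succ {P : State n → Prop} :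
    ∀ {j : ℕ} {s : State n}, ForceWithin P j s → ForceWithin P (j + 1) s
  | 0, _, h => Or.inl h
  | _ + 1, _, h => by
    rcases h with h | ⟨w, hw, h⟩
    · exact Or.inl h
    · exact Or.inr ⟨w, hw, fun t ht => (h t ht).succ⟩

lemma ForceWithin.mono {P : State n → Prop} {i j : ℕ} (hij : i ≤ j) {s : State n}
    (h : ForceWithin P i s) : ForceWithin P j s := by
  induction hij with
  | refl => exact h
  | step _ ih => exact ih.succ

lemma Force.done {P : State n → Prop} {s : State n} (h : P s) : Force P s := ⟨0, h⟩

lemma finite_breaker_turns (s : State n) : {t | LegalTurn .breaker s t}.Finite := by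
  apply ((Set.finite_range s.breakerClaim).insert s).subset
  rintro t (⟨e, _, rfl⟩ | ⟨_, rfl⟩)
  · exact Or.inr ⟨e, rfl⟩
  · exact Or.inl rfl

/-- The number of rounds that Walker needs is bounded over all answers of Breaker, since there are
only finitely many of them. -/
lemma Force.step {P : State n → Prop} {s : State n} (w : Fin n) (hw : s.CanWalkTo w)
    (h : ∀ t, LegalTurn .breaker (s.walkTo w) t → Force P t) : Force P s := by
  classical
  choose f hf using h
  let g : State n → ℕ := fun t => if ht : LegalTurn .breaker (s.walkTo w) t then f t ht else 0
  obtain ⟨b, hb⟩ := ((finite_breaker_turns (s.walkTo w)).image g).bddAbove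
  refine ⟨b + 1, Or.inr ⟨w, hw, fun t ht => (hf t ht).mono ?_⟩⟩
  have := hb ⟨t, ht, rfl⟩
  simpa [g, ht] using this

lemma Force.bind {P Q : State n → Prop} {s : State n} (h : Force P s)
    (hPQ : ∀ t, P t → Force Q t) : Force Q s := by
  obtain ⟨j, h⟩ := h
  induction j generalizing s with
  | zero => exact hPQ s h
  | succ j ih =>
    rcases h with h | ⟨w, hw, h⟩
    · exact hPQ s h
    · exact Force.step w hw fun t ht => ih (h t ht)

lemma Force.mono {P Q : State n → Prop} {s : State n} (h : Force P s) (hPQ : ∀ t, P t → Q t) :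
    Force Q s := h.bind fun t ht => Force.done (hPQ t ht)

/-- The move to `w` decreases the number of rounds that Walker needs in order to force `P`. -/
def IsProgress (P : State n → Prop) (s : State n) (w : Fin n) : Prop :=
  s.CanWalkTo w ∧ ∀ j, ForceWithin P (j + 1) s → ¬ ForceWithin P j s →
    ∀ t, LegalTurn .breaker (s.walkTo w) t → ForceWithin P j t

lemma exists_isProgress {P : State n → Prop} {s : State n} {j : ℕ} (h : ForceWithin P (j + 1) s)
    (h' : ¬ ForceWithin P j s) : ∃ w, IsProgress P s w := by
  rcases h with hP | ⟨w, hw, hf⟩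
  · exact absurd (ForceWithin.of_goal hP j) h'
  refine ⟨w, hw, fun i hi hi' => ?_⟩
  have h1 : i ≤ j := by
    by_contra! hlt
    exact hi' (ForceWithin.mono hlt (Or.inr ⟨w, hw, hf⟩))
  have h2 : j ≤ i := by
    by_contra! hlt
    exact h' (ForceWithin.mono hlt hi)
  obtain rfl : i = j := le_antisymm h1 h2
  exact hf

open Classical in
/-- Walker's strategy that makes progress towards `P` whenever this is possible. -/
noncomputable def progressStrategy (P : State n → Prop) : Strategy n .walker where
  next _ s :=
    if h : ∃ w, IsProgress P s w then s.walkTo h.choose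
    else if h : ∃ w, s.CanWalkTo w then s.walkTo h.choose else s
  legal _ s := by
    by_cases h : ∃ w, IsProgress P s w
    · simp only [h, dif_pos]
      exact Or.inl ⟨_, h.choose_spec.1, rfl⟩
    · by_cases h' : ∃ w, s.CanWalkTo w
      · simp only [h, h', dif_pos, dif_neg, not_false_eq_true]
        exact Or.inl ⟨_, h'.choose_spec, rfl⟩
      · simp only [h, h', dif_neg, not_false_eq_true]
        exact Or.inr ⟨fun w hw => h' ⟨w, hw⟩, rfl⟩

lemma mover_succ (first : Player) (k : ℕ) : mover first (k + 1) = (mover first k).other := by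
  unfold mover
  by_cases h : Even k
  · simp [h, Nat.even_add_one]
  · cases first <;> simp [h, Nat.even_add_one, Player.other]

lemma progressStrategy_wins {P : State n → Prop} {first : Player} {v : Fin n}
    {p : ℕ → State n} (hp : IsPlay first v p) (hσ : (progressStrategy P).FollowedIn first p)
    (j : ℕ) : ∀ k, mover first k = .walker → ForceWithin P j (p k) → ∃ m, P (p m) := by
  induction j with
  | zero => exact fun k _ h => ⟨k, h⟩
  | succ j ih =>
    intro k hk h
    by_cases h' : ForceWithin P j (p k)
    · exact ih k hk h'
    have hex := exists_isProgress h h'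
    have hnext : p (k + 1) = (p k).walkTo hex.choose := by
      rw [hσ k hk]
      simp [progressStrategy, hex]
    have hk1 : mover first (k + 1) = .breaker := by rw [mover_succ, hk]; rfl
    have hturn := hp.2 (k + 1)
    rw [hk1, hnext] at hturn
    refine ih (k + 2) ?_ (hex.choose_spec.2 j h h' _ hturn)
    rw [mover_succ, hk1]; rfl

/-- To win, it suffices for Walker to be able to force a cycle with her to move, whether or not
Breaker has already made one turn. -/
lemma walkerCanCreateCycle_of_force {v : Fin n} {ℓ : ℕ}
    (h : ∀ s : State n, s = State.init v ∨ LegalTurn .breaker (State.init v) s →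
      Force (fun t => t.HasWalkerCycle ℓ) s) (first : Player) :
    WalkerCanCreateCycle first v ℓ := by
  refine ⟨progressStrategy fun t => t.HasWalkerCycle ℓ, fun p hp hσ => ?_⟩
  cases first with
  | walker =>
    obtain ⟨j, hj⟩ := h (p 0) (Or.inl hp.1)
    exact progressStrategy_wins hp hσ j 0 rfl hj
  | breaker =>
    have h0 := hp.2 0
    rw [hp.1] at h0
    obtain ⟨j, hj⟩ := h (p 1) (Or.inr h0)
    exact progressStrategy_wins hp hσ j 1 rfl hj

/-- A turn of Breaker: he adds at most one edge. -/
lemma LegalTurn.breaker_spec {s t : State n} (h : LegalTurn .breaker s t) :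
    t.pos = s.pos ∧ t.walkerEdges = s.walkerEdges ∧
      ∃ x y, t.breakerEdges = s.breakerEdges ∨
        (x ≠ y ∧ t.breakerEdges = insert s(x, y) s.breakerEdges) := by
  rcases h with ⟨e, he, rfl⟩ | ⟨_, rfl⟩
  · induction e using Sym2.ind with
    | _ x y =>
      refine ⟨rfl, rfl, x, y, Or.inr ⟨?_, rfl⟩⟩
      simpa using he.1
  · exact ⟨rfl, rfl, t.pos, t.pos, Or.inl rfl⟩

/-! ### Closed tours in Walker's graph -/

/-- Walker owns the edge `xy`. -/
def State.WAdj (s : State n) (x y : Fin n) : Prop := s(x, y) ∈ s.walkerEdges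

lemma State.WAdj.symm {s : State n} {x y : Fin n} (h : s.WAdj x y) : s.WAdj y x := by
  unfold State.WAdj; rw [Sym2.eq_swap]; exact h

lemma WAdj.flip (s : State n) : (fun x y => s.WAdj y x) = s.WAdj := by
  ext x y; exact ⟨State.WAdj.symm, State.WAdj.symm⟩

/-- The vertices `v :: t` are distinct and form, in this cyclic order, a closed tour along Walker's
edges. A tour with at least three vertices is a cycle. -/
structure State.IsTour (s : State n) (v : Fin n) (t : List (Fin n)) : Prop where
  nodup : (v :: t).Nodup
  chain : (v :: t ++ [v]).IsChain s.WAdj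

lemma State.IsTour.mono {s s' : State n} {v : Fin n} {t : List (Fin n)} (h : s.IsTour v t)
    (hs : s.walkerEdges ⊆ s'.walkerEdges) : s'.IsTour v t :=
  ⟨h.nodup, h.chain.imp fun _ _ h => hs h⟩

lemma State.IsTour.reverse {s : State n} {v : Fin n} {t : List (Fin n)} (h : s.IsTour v t) :
    s.IsTour v t.reverse := by
  refine ⟨?_, ?_⟩
  · have := h.nodup
    simpa using this
  · have := List.isChain_reverse.2 ((WAdj.flip s).symm ▸ h.chain)
    simpa using this

lemma State.IsTour.rotate {s : State n} {v x : Fin n} {l₁ l₂ : List (Fin n)}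
    (h : s.IsTour v (l₁ ++ x :: l₂)) : s.IsTour x (l₂ ++ v :: l₁) := by
  refine ⟨?_, ?_⟩
  · have h1 := h.nodup
    have : (x :: (l₂ ++ v :: l₁)).Perm (v :: (l₁ ++ x :: l₂)) := by
      have := List.perm_append_comm (l₁ := x :: l₂) (l₂ := v :: l₁)
      simpa using this
    exact this.nodup_iff.2 h1
  · have h1 := h.chain
    have e1 : v :: (l₁ ++ x :: l₂) ++ [v] = (v :: l₁) ++ x :: (l₂ ++ [v]) := by simp
    have e2 : x :: (l₂ ++ v :: l₁) ++ [x] = (x :: l₂) ++ v :: (l₁ ++ [x]) := by simp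
    rw [e1, List.isChain_split] at h1
    rw [e2, List.isChain_split]
    exact ⟨by simpa using h1.2, by simpa using h1.1⟩

/-- A detour from `v` through `w :: ws` and back to the predecessor `b` of `v` enlarges a tour. -/
lemma State.IsTour.insert_detour {s : State n} {v b w : Fin n} {t ws : List (Fin n)}
    (h : s.IsTour v (t ++ [b])) (hws : (w :: ws ++ [v]).IsChain s.WAdj)
    (hnd : (w :: ws ++ v :: (t ++ [b])).Nodup) (hbw : s.WAdj b w) :
    s.IsTour w (ws ++ v :: (t ++ [b])) := by
  refine ⟨by simpa using hnd, ?_⟩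
  have e : w :: (ws ++ v :: (t ++ [b])) ++ [w] = (w :: ws) ++ v :: (t ++ [b] ++ [w]) := by simp
  rw [e, List.isChain_split]
  refine ⟨hws, ?_⟩
  have h1 := h.chain
  have e1 : v :: (t ++ [b]) ++ [v] = (v :: t) ++ b :: [v] := by simp
  have e2 : v :: (t ++ [b] ++ [w]) = (v :: t) ++ b :: [w] := by simp
  rw [e1, List.isChain_split] at h1
  rw [e2, List.isChain_split]
  exact ⟨h1.1, by simpa using hbw⟩

lemma State.IsTour.hasWalkerCycle {s : State n} {v : Fin n} {t : List (Fin n)}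
    (h : s.IsTour v t) (ht : 2 ≤ t.length) : s.HasWalkerCycle (t.length + 1) := by
  have hadj : ∀ x y, x ≠ y → s.WAdj x y → s.walkerGraph.Adj x y := by
    intro x y hxy hw
    exact (SimpleGraph.fromEdgeSet_adj _).2 ⟨Finset.mem_coe.2 hw, hxy⟩
  have key : ∀ (t : List (Fin n)) (v : Fin n), (v :: t).Nodup → (v :: t).IsChain s.WAdj →
      ∃ p : s.walkerGraph.Walk v ((v :: t).getLast (by simp)),
        p.support = v :: t := by
    intro t
    induction t with
    | nil => intro v _ _; exact ⟨SimpleGraph.Walk.nil, rfl⟩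
    | cons x t ih =>
      intro v hnd hch
      obtain ⟨p, hp⟩ := ih x (List.nodup_cons.1 hnd).2 (List.isChain_cons_cons.1 hch).2
      have hvx : v ≠ x := by
        rintro rfl; simp at hnd
      have hl : (v :: x :: t).getLast (by simp) = (x :: t).getLast (by simp) := by simp
      refine ⟨(SimpleGraph.Walk.cons (hadj v x hvx (List.isChain_cons_cons.1 hch).1) p).copy rfl
        hl.symm, ?_⟩
      simp [hp]
  have hch : (v :: t).IsChain s.WAdj := (List.isChain_append.1 h.chain).1
  have hlast : s.WAdj ((v :: t).getLast (by simp)) v := by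
    have := (List.isChain_append.1 h.chain).2.2
    exact this _ (List.getLast?_eq_getLast_of_ne_nil (by simp)) v (by simp)
  obtain ⟨p, hp⟩ := key t v h.nodup hch
  have hpath : p.IsPath := by
    rw [SimpleGraph.Walk.isPath_def, hp]; exact h.nodup
  have hne : (v :: t).getLast (by simp) ≠ v := by
    intro heq
    have hne' : t ≠ [] := by rintro rfl; simp at ht
    rw [List.getLast_cons hne'] at heq
    exact (List.nodup_cons.1 h.nodup).1 (heq ▸ List.getLast_mem hne')
  have hlen : p.length = t.length := by
    have := p.length_support
    rw [hp] at this
    simpa using this.symm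
  refine ⟨_, SimpleGraph.Walk.cons (hadj _ _ hne hlast) p, ?_, ?_⟩
  · rw [SimpleGraph.Walk.cons_isCycle_iff]
    refine ⟨hpath, fun hmem => ?_⟩
    -- a path of length at least two does not use the edge joining its ends
    have := hpath.length_eq_one_of_mem_edges (Sym2.eq_swap ▸ hmem)
    omega
  · simp [hlen]

/-! ### Breaker keeps two vertices off all cycles -/

/-- A vertex with at most one neighbour in Walker's graph lies on no cycle of it. -/
lemma not_mem_support_of_isCycle {s : State n} {x b : Fin n} (hx : ∀ y, s.WAdj x y → y = b)
    {u : Fin n} {c : s.walkerGraph.Walk u u} (hc : c.IsCycle) : x ∉ c.support := by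
  intro hmem
  have h2 := hc.ncard_neighborSet_toSubgraph_eq_two hmem
  have hsub : c.toSubgraph.neighborSet x ⊆ {b} := by
    intro y hy
    have h1 : s.walkerGraph.Adj x y := c.toSubgraph.adj_sub hy
    exact hx y (Finset.mem_coe.1 ((SimpleGraph.fromEdgeSet_adj _).1 h1).1)
  have h1 := Set.ncard_le_ncard hsub (Set.finite_singleton b)
  rw [Set.ncard_singleton] at h1
  omega

lemma not_hasWalkerCycle_of_two {s : State n} {x y p q : Fin n} (hxy : x ≠ y)
    (hx : ∀ z, s.WAdj x z → z = p) (hy : ∀ z, s.WAdj y z → z = q) {m : ℕ} (hm : n - 2 < m) :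
    ¬ s.HasWalkerCycle m := by
  rintro ⟨u, c, hc, rfl⟩
  have h1 := not_mem_support_of_isCycle hx hc
  have h2 := not_mem_support_of_isCycle hy hc
  have hnd := hc.support_nodup
  have hlen : c.support.tail.length = c.length := by simp
  have hsub : c.support.tail.toFinset ⊆ (Finset.univ.erase x).erase y := by
    intro z hz
    have hz' : z ∈ c.support := List.mem_of_mem_tail (List.mem_toFinset.1 hz)
    simp only [Finset.mem_erase, Finset.mem_univ, and_true]
    exact ⟨fun h => h2 (h ▸ hz'), fun h => h1 (h ▸ hz')⟩
  have hcard := Finset.card_le_card hsub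
  rw [List.toFinset_card_of_nodup hnd, hlen, Finset.card_erase_of_mem (by simp [hxy.symm]),
    Finset.card_erase_of_mem (by simp)] at hcard
  simp at hcard
  omega

open Classical in
/-- The vertices other than `u` and the start vertex `v` that Walker has not visited yet. -/
noncomputable def State.unvisited (s : State n) (u v : Fin n) : Finset (Fin n) :=
  Finset.univ.filter fun x => x ≠ u ∧ x ≠ v ∧ ∀ y, ¬ s.WAdj x y

lemma State.mem_unvisited {s : State n} {u v x : Fin n} :
    x ∈ s.unvisited u v ↔ x ≠ u ∧ x ≠ v ∧ ∀ y, ¬ s.WAdj x y := by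
  simp [State.unvisited]

open Classical in
/-- The edge that Breaker wants: from Walker's position to the only unvisited vertex besides `u`
if there is just one, and to `u` otherwise. -/
noncomputable def State.wanted (s : State n) (u v : Fin n) : Sym2 (Fin n) :=
  if h : ∃ c, s.unvisited u v = {c} then s(s.pos, h.choose) else s(s.pos, u)

lemma State.wanted_of_eq_singleton {s : State n} {u v c : Fin n} (h : s.unvisited u v = {c}) :
    s.wanted u v = s(s.pos, c) := by
  have hex : ∃ c, s.unvisited u v = {c} := ⟨c, h⟩
  have : hex.choose = c := by
    have := h.symm.trans hex.choose_spec
    simpa using this.symm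
  simp [State.wanted, hex, this]

lemma State.wanted_of_two_le {s : State n} {u v : Fin n} (h : 2 ≤ (s.unvisited u v).card) :
    s.wanted u v = s(s.pos, u) := by
  have hex : ¬ ∃ c, s.unvisited u v = {c} := by
    rintro ⟨c, hc⟩
    simp [hc] at h
  simp [State.wanted, hex]

open Classical in
/-- Breaker claims the edge that he wants if it is free. -/
noncomputable def isolatingStrategy (u v : Fin n) : Strategy n .breaker where
  next _ s :=
    if s.IsFree (s.wanted u v) then s.breakerClaim (s.wanted u v)
    else if h : ∃ e, s.IsFree e then s.breakerClaim h.choose else s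
  legal _ s := by
    by_cases h : s.IsFree (s.wanted u v)
    · simp only [h, if_true]
      exact Or.inl ⟨_, h, rfl⟩
    · by_cases h' : ∃ e, s.IsFree e
      · simp only [h, h', if_false, dif_pos]
        exact Or.inl ⟨_, h'.choose_spec, rfl⟩
      · simp only [h, h', if_false, dif_neg, not_false_eq_true]
        exact Or.inr ⟨fun e he => h' ⟨e, he⟩, rfl⟩

lemma isolatingStrategy_spec (u v : Fin n) (past : List (State n)) (s : State n) :
    ((isolatingStrategy u v).next past s).pos = s.pos ∧
    ((isolatingStrategy u v).next past s).walkerEdges = s.walkerEdges ∧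
    s.breakerEdges ⊆ ((isolatingStrategy u v).next past s).breakerEdges ∧
    (s.IsFree (s.wanted u v) →
      s.wanted u v ∈ ((isolatingStrategy u v).next past s).breakerEdges) := by
  by_cases h : s.IsFree (s.wanted u v)
  · simp [isolatingStrategy, h, State.breakerClaim]
  · by_cases h' : ∃ e, s.IsFree e
    · simp [isolatingStrategy, h, h', State.breakerClaim]
    · simp [isolatingStrategy, h, h']

/-- At least two vertices besides `u` are unvisited, and all edges between `u` and the visited
vertices are Breaker's, except possib' the one at Walker's position if it is Breaker's turn. -/
structure State.EarlyPhase (s : State n) (u v : Fin n) (P : Player) : Prop where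
  two_le : 2 ≤ (s.unvisited u v).card
  pos_ne : s.pos ≠ u
  pos_not_mem : s.pos ∉ s.unvisited u v
  not_adj : ∀ y, ¬ s.WAdj u y
  blocked : ∀ x, x ≠ u → x ∉ s.unvisited u v → (P = .breaker → x ≠ s.pos) →
    s(x, u) ∈ s.breakerEdges

/-- Besides `u`, only `c` is unvisited; Walker can enter and leave `u` only through `b` or `c`, and
`c` is blocked from Walker's position once Breaker has answered. -/
structure State.LatePhase (s : State n) (u v : Fin n) (P : Player) (b c : Fin n) : Prop where
  unvisited_eq : s.unvisited u v = {c}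
  pos_ne : s.pos ≠ c
  adj : ∀ y, s.WAdj u y → y = b
  blocked : ∀ x, x ≠ u → x ≠ b → x ≠ c → s(x, u) ∈ s.breakerEdges
  guarded : P = .walker → s(s.pos, c) ∈ s.breakerEdges

/-- The invariant that Breaker maintains. -/
def State.Isolating (s : State n) (u v : Fin n) (P : Player) : Prop :=
  s.EarlyPhase u v P ∨ ∃ b c, s.LatePhase u v P b c

lemma unvisited_congr {s t : State n} (h : t.walkerEdges = s.walkerEdges) (u v : Fin n) :
    t.unvisited u v = s.unvisited u v := by
  ext x; simp [State.mem_unvisited, State.WAdj, h]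

lemma Isolating.breaker_turn {s : State n} {u v : Fin n} (h : s.Isolating u v .breaker)
    (past : List (State n)) :
    ((isolatingStrategy u v).next past s).Isolating u v .walker := by
  obtain ⟨hpos, hW, hB, hwant⟩ := isolatingStrategy_spec u v past s
  set t := (isolatingStrategy u v).next past s
  have hun := unvisited_congr hW u v
  have hadj : ∀ x y, t.WAdj x y ↔ s.WAdj x y := by intro x y; simp [State.WAdj, hW]
  rcases h with h | ⟨b, c, h⟩
  · left
    have hmem : s(s.pos, u) ∈ t.breakerEdges := by
      rw [State.wanted_of_two_le h.two_le] at hwant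
      by_cases hb : s(s.pos, u) ∈ s.breakerEdges
      · exact hB hb
      · refine hwant ⟨by simpa using h.pos_ne, fun hw => ?_, hb⟩
        exact h.not_adj _ (State.WAdj.symm hw)
    refine ⟨hun ▸ h.two_le, hpos ▸ h.pos_ne, by rw [hun, hpos]; exact h.pos_not_mem,
      fun y hy => h.not_adj y ((hadj _ _).1 hy), fun x hxu hx _ => ?_⟩
    by_cases hxp : x = s.pos
    · rw [hxp]; exact hmem
    · exact hB (h.blocked x hxu (hun ▸ hx) fun _ => hxp)
  · right
    refine ⟨b, c, hun ▸ h.unvisited_eq, hpos ▸ h.pos_ne, fun y hy => h.adj y ((hadj _ _).1 hy),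
      fun x h1 h2 h3 => hB (h.blocked x h1 h2 h3), fun _ => ?_⟩
    rw [hpos]
    rw [State.wanted_of_eq_singleton h.unvisited_eq] at hwant
    have hc : c ∈ s.unvisited u v := by simp [h.unvisited_eq]
    by_cases hb : s(s.pos, c) ∈ s.breakerEdges
    · exact hB hb
    · refine hwant ⟨by simpa using h.pos_ne, fun hw => ?_, hb⟩
      exact (State.mem_unvisited.1 hc).2.2 _ (State.WAdj.symm hw)

lemma walkTo_wadj {s : State n} {w x y : Fin n} :
    (s.walkTo w).WAdj x y ↔ s.WAdj x y ∨ (x = s.pos ∧ y = w) ∨ (x = w ∧ y = s.pos) := by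
  simp [State.WAdj, State.walkTo, or_comm]

lemma unvisited_walkTo {s : State n} {u v w : Fin n} (hpos : s.pos ∉ s.unvisited u v) :
    (s.walkTo w).unvisited u v = (s.unvisited u v).erase w := by
  ext x
  simp only [Finset.mem_erase, State.mem_unvisited, walkTo_wadj] at hpos ⊢
  constructor
  · rintro ⟨h1, h2, h3⟩
    exact ⟨fun hxw => h3 s.pos (Or.inr (Or.inr ⟨hxw, rfl⟩)), h1, h2, fun y hy => h3 y (Or.inl hy)⟩
  · rintro ⟨h0, h1, h2, h3⟩
    refine ⟨h1, h2, ?_⟩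
    rintro y (hy | ⟨hx, -⟩ | ⟨hx, -⟩)
    · exact h3 y hy
    · exact hpos ⟨hx ▸ h1, hx ▸ h2, fun z hz => h3 z (hx ▸ hz)⟩
    · exact h0 hx

lemma Isolating.walker_turn {s t : State n} {u v : Fin n} (h : s.Isolating u v .walker)
    (ht : LegalTurn .walker s t) : t.Isolating u v .breaker := by
  rcases ht with ⟨w, ⟨hpw, hfree⟩, rfl⟩ | ⟨_, rfl⟩
  swap
  · rcases h with h | ⟨b, c, h⟩
    · exact Or.inl ⟨h.two_le, h.pos_ne, h.pos_not_mem, h.not_adj,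
        fun x h1 h2 _ => h.blocked x h1 h2 (by simp)⟩
    · exact Or.inr ⟨b, c, h.unvisited_eq, h.pos_ne, h.adj, h.blocked, by simp⟩
  rcases h with h | ⟨b, c, h⟩
  · have hwu : w ≠ u := by
      rintro rfl
      exact hfree (h.blocked _ h.pos_ne h.pos_not_mem (by simp))
    have hun := unvisited_walkTo (w := w) h.pos_not_mem
    have hnadj : ∀ y, ¬ (s.walkTo w).WAdj u y := by
      intro y hy
      rcases walkTo_wadj.1 hy with hy | ⟨hy, -⟩ | ⟨hy, -⟩
      · exact h.not_adj y hy
      · exact h.pos_ne hy.symm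
      · exact hwu hy.symm
    have hblock : ∀ x, x ≠ u → x ∉ (s.walkTo w).unvisited u v → x ≠ w →
        s(x, u) ∈ s.breakerEdges := by
      intro x hxu hx hxw
      rw [hun] at hx
      exact h.blocked x hxu (fun hx' => hx (Finset.mem_erase.2 ⟨hxw, hx'⟩)) (by simp)
    by_cases h2 : 2 ≤ ((s.walkTo w).unvisited u v).card
    · left
      exact ⟨h2, hwu, by rw [hun]; simp [State.walkTo], hnadj,
        fun x h1 h2 h3 => hblock x h1 h2 (h3 rfl)⟩
    · -- only one unvisited vertex remains, so Breaker now cuts it off from `w` and leaves `wu` free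
      right
      have hcard : ((s.walkTo w).unvisited u v).card = 1 := by
        have h3 := h.two_le
        have h4 := Finset.pred_card_le_card_erase (s := s.unvisited u v) (a := w)
        rw [← hun] at h4
        omega
      obtain ⟨c, hc⟩ := Finset.card_eq_one.1 hcard
      refine ⟨w, c, hc, ?_, fun y hy => absurd hy (hnadj y), fun x h1 h2 h3 => ?_, by simp⟩
      · have : c ∈ (s.unvisited u v).erase w := by rw [← hun, hc]; simp
        exact (Finset.mem_erase.1 this).1.symm
      · exact hblock x h1 (by rw [hc]; simpa using h3) h2
  · right
    have hpos : s.pos ∉ s.unvisited u v := by rw [h.unvisited_eq]; simpa using h.pos_ne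
    have hwc : w ≠ c := by
      rintro rfl
      exact hfree (h.guarded rfl)
    refine ⟨b, c, ?_, hwc, ?_, h.blocked, by simp⟩
    · rw [unvisited_walkTo hpos, h.unvisited_eq]
      exact Finset.erase_eq_of_notMem (by simpa using hwc)
    · intro y hy
      rcases walkTo_wadj.1 hy with hy | ⟨hu, rfl⟩ | ⟨rfl, rfl⟩
      · exact h.adj y hy
      · by_contra hyb
        apply hfree
        rw [Sym2.eq_swap, ← hu]
        exact h.blocked y (fun h' => hpw (hu.symm.trans h'.symm)) hyb hwc
      · by_contra hyb
        exact hfree (h.blocked _ hpw hyb h.pos_ne)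

lemma Isolating.not_hasWalkerCycle {s : State n} {u v : Fin n} {P : Player}
    (h : s.Isolating u v P) {m : ℕ} (hm : n - 2 < m) : ¬ s.HasWalkerCycle m := by
  rcases h with h | ⟨b, c, h⟩
  · obtain ⟨x, hx, y, hy, hxy⟩ := Finset.one_lt_card.1 (show 1 < (s.unvisited u v).card from h.two_le)
    exact not_hasWalkerCycle_of_two (p := u) (q := u) hxy
      (fun z hz => absurd hz ((State.mem_unvisited.1 hx).2.2 z))
      (fun z hz => absurd hz ((State.mem_unvisited.1 hy).2.2 z)) hm
  · have hc := State.mem_unvisited.1 (show c ∈ s.unvisited u v by simp [h.unvisited_eq])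
    exact not_hasWalkerCycle_of_two (p := u) (q := b) hc.1
      (fun z hz => absurd hz (hc.2.2 z)) h.adj hm

theorem breakerCanPreventLongerCycles (hn : 4 ≤ n) (v : Fin n) :
    BreakerCanPreventLongerCycles .breaker v (n - 2) := by
  obtain ⟨u, hu⟩ : ∃ u : Fin n, u ≠ v := by
    have : Nontrivial (Fin n) := Fin.nontrivial_iff_two_le.2 (by omega)
    exact exists_ne v
  refine ⟨isolatingStrategy u v, fun p hp hτ k m hm => ?_⟩
  have hinv : (p k).Isolating u v (mover .breaker k) := by
    induction k with
    | zero =>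
      left
      rw [hp.1]
      have hun : (State.init v).unvisited u v = (Finset.univ.erase u).erase v := by
        ext x
        simp [State.mem_unvisited, State.init, State.WAdj, and_comm]
      refine ⟨?_, hu.symm, ?_, fun y hy => ?_, fun x h1 h2 h3 => ?_⟩
      · rw [hun, Finset.card_erase_of_mem (by simp [hu.symm]), Finset.card_erase_of_mem (by simp)]
        simp; omega
      · rw [hun]; simp [State.init]
      · simp [State.init, State.WAdj] at hy
      · rw [hun] at h2
        have h4 := h3 rfl
        simp [State.init, h1] at h2 h4
        exact absurd h2 h4
    | succ k ih =>
      rw [mover_succ]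
      cases hk : mover .breaker k with
      | walker =>
        rw [hk] at ih
        have := hp.2 k
        rw [hk] at this
        exact Isolating.walker_turn ih this
      | breaker =>
        rw [hk] at ih
        rw [hτ k hk]
        exact Isolating.breaker_turn ih _
  exact Isolating.not_hasWalkerCycle hinv hm

/-! ### Degrees in Breaker's graph and single rounds -/

/-- The vertices joined to `x` by an edge of Breaker. -/
def State.nbrs (s : State n) (x : Fin n) : Finset (Fin n) :=
  Finset.univ.filter fun y => s(x, y) ∈ s.breakerEdges

/-- The degree of `x` in Breaker's graph. -/
def State.deg (s : State n) (x : Fin n) : ℕ := (s.nbrs x).card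

/-- The number of vertices of degree at least `h` in Breaker's graph among those in `X`. -/
def State.highCount (s : State n) (h : ℕ) (X : Finset (Fin n)) : ℕ :=
  (X.filter fun z => h ≤ s.deg z).card

lemma State.mem_nbrs {s : State n} {x y : Fin n} : y ∈ s.nbrs x ↔ s(x, y) ∈ s.breakerEdges := by
  simp [State.nbrs]

lemma State.mem_nbrs' {s : State n} {x y : Fin n} : y ∈ s.nbrs x ↔ s(y, x) ∈ s.breakerEdges := by
  rw [State.mem_nbrs, Sym2.eq_swap]

lemma State.sum_deg_le (s : State n) : ∑ x, s.deg x ≤ 2 * s.breakerEdges.card := by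
  have h1 : ∑ x, s.deg x
      = ((Finset.univ : Finset (Fin n × Fin n)).filter
          fun p => s(p.1, p.2) ∈ s.breakerEdges).card := by
    rw [Finset.card_filter, Fintype.sum_prod_type]
    refine Finset.sum_congr rfl fun x _ => ?_
    rw [State.deg, State.nbrs, Finset.card_filter]
  rw [h1]
  refine Finset.card_le_mul_card_image_of_maps_to (f := fun p : Fin n × Fin n => s(p.1, p.2))
    (fun p hp => (Finset.mem_filter.1 hp).2) 2 fun e _ => ?_
  induction e using Sym2.ind with
  | _ x y =>
    refine (Finset.card_le_card (t := {(x, y), (y, x)}) ?_).trans Finset.card_le_two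
    rintro ⟨a, b⟩ h
    have := (Finset.mem_filter.1 h).2
    simpa using this

lemma State.highCount_mul_le (s : State n) (h : ℕ) (X : Finset (Fin n)) :
    s.highCount h X * h ≤ 2 * s.breakerEdges.card := by
  refine le_trans ?_ s.sum_deg_le
  calc s.highCount h X * h = ∑ _z ∈ X.filter (fun z => h ≤ s.deg z), h := by
        simp [State.highCount]
    _ ≤ ∑ z ∈ X.filter (fun z => h ≤ s.deg z), s.deg z :=
        Finset.sum_le_sum fun z hz => (Finset.mem_filter.1 hz).2
    _ ≤ ∑ z, s.deg z := Finset.sum_le_sum_of_subset (Finset.subset_univ _)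

lemma State.deg_le_card (s : State n) (x : Fin n) : s.deg x ≤ s.breakerEdges.card := by
  refine Finset.card_le_card_of_injOn (fun y => s(x, y)) (fun y hy => ?_) fun y _ z _ h => ?_
  · exact State.mem_nbrs.1 hy
  · exact Sym2.congr_right.1 h

/-- One round: Walker walks from `s` to `w`, then Breaker adds at most one edge, leading to `t`. -/
structure Round (s : State n) (w : Fin n) (t : State n) : Prop where
  pos_eq : t.pos = w
  walkerEdges_eq : t.walkerEdges = insert s(s.pos, w) s.walkerEdges
  breakerEdges_eq : ∃ x y, t.breakerEdges = s.breakerEdges ∨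
    (x ≠ y ∧ t.breakerEdges = insert s(x, y) s.breakerEdges)

lemma Force.round {P : State n → Prop} {s : State n} (w : Fin n) (hw : s.CanWalkTo w)
    (h : ∀ t, Round s w t → Force P t) : Force P s :=
  Force.step w hw fun t ht => h t ⟨ht.breaker_spec.1, ht.breaker_spec.2.1, ht.breaker_spec.2.2⟩

section Round

variable {s t : State n} {w : Fin n}

lemma Round.subset (h : Round s w t) : s.breakerEdges ⊆ t.breakerEdges := by
  obtain ⟨x, y, h | ⟨-, h⟩⟩ := h.breakerEdges_eq
  · rw [h]
  · rw [h]; exact Finset.subset_insert _ _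

lemma Round.walkerEdges_subset (h : Round s w t) : s.walkerEdges ⊆ t.walkerEdges := by
  rw [h.walkerEdges_eq]; exact Finset.subset_insert _ _

lemma Round.wadj (h : Round s w t) : t.WAdj s.pos w := by
  unfold State.WAdj; rw [h.walkerEdges_eq]; exact Finset.mem_insert_self _ _

lemma Round.card_le (h : Round s w t) : t.breakerEdges.card ≤ s.breakerEdges.card + 1 := by
  obtain ⟨x, y, h | ⟨-, h⟩⟩ := h.breakerEdges_eq
  · rw [h]; omega
  · rw [h]; exact Finset.card_insert_le _ _

lemma Round.nbrs_subset (h : Round s w t) (z : Fin n) : ∃ y, t.nbrs z ⊆ insert y (s.nbrs z) := by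
  obtain ⟨x, y, h | ⟨-, h⟩⟩ := h.breakerEdges_eq
  · refine ⟨z, fun a ha => Finset.mem_insert_of_mem ?_⟩
    rw [State.mem_nbrs] at ha ⊢
    rwa [h] at ha
  · refine ⟨if z = x then y else x, fun a ha => ?_⟩
    rw [State.mem_nbrs, h, Finset.mem_insert] at ha
    rw [Finset.mem_insert, State.mem_nbrs]
    rcases ha with ha | ha
    · left
      rw [Sym2.eq_iff] at ha
      rcases ha with ⟨rfl, rfl⟩ | ⟨rfl, rfl⟩
      · simp
      · split_ifs with h1
        · exact h1.symm
        · rfl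
    · exact Or.inr ha

lemma Round.deg_le (h : Round s w t) (z : Fin n) : t.deg z ≤ s.deg z + 1 := by
  obtain ⟨y, hy⟩ := h.nbrs_subset z
  exact (Finset.card_le_card hy).trans (Finset.card_insert_le _ _)

lemma Round.outDeg_le (h : Round s w t) (z : Fin n) {X Y : Finset (Fin n)} (hXY : X ⊆ Y) :
    (t.nbrs z \ Y).card ≤ (s.nbrs z \ X).card + 1 := by
  obtain ⟨y, hy⟩ := h.nbrs_subset z
  refine (Finset.card_le_card (t := insert y (s.nbrs z \ X)) fun a ha => ?_).trans
    (Finset.card_insert_le _ _)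
  rw [Finset.mem_sdiff] at ha
  have := hy ha.1
  rw [Finset.mem_insert] at this ⊢
  rcases this with h1 | h1
  · exact Or.inl h1
  · exact Or.inr (Finset.mem_sdiff.2 ⟨h1, fun h2 => ha.2 (hXY h2)⟩)

lemma Round.nbrs_mono (h : Round s w t) (z : Fin n) : s.nbrs z ⊆ t.nbrs z := fun a ha => by
  rw [State.mem_nbrs] at ha ⊢
  exact h.subset ha

lemma Round.deg_mono (h : Round s w t) (z : Fin n) : s.deg z ≤ t.deg z :=
  Finset.card_le_card (h.nbrs_mono z)

lemma Round.highCount_mono (hr : Round s w t) (h : ℕ) {X Y : Finset (Fin n)} (hXY : X ⊆ Y) :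
    s.highCount h X ≤ t.highCount h Y := by
  refine Finset.card_le_card fun z hz => ?_
  rw [Finset.mem_filter] at hz ⊢
  exact ⟨hXY hz.1, hz.2.trans (hr.deg_mono z)⟩

/-- If Breaker claims a new edge `xy` in a round, no other vertex changes its degree. -/
lemma Round.nbrs_eq (h : Round s w t) {x y z : Fin n} (hxy : s(x, y) ∉ s.breakerEdges)
    (hxy' : s(x, y) ∈ t.breakerEdges) (hzx : z ≠ x) (hzy : z ≠ y) : t.nbrs z = s.nbrs z := by
  obtain ⟨x', y', h | ⟨-, h⟩⟩ := h.breakerEdges_eq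
  · rw [h] at hxy'; exact absurd hxy' hxy
  · rw [h, Finset.mem_insert] at hxy'
    have he : s(x, y) = s(x', y') := hxy'.resolve_right hxy
    rw [← he] at h
    ext a
    rw [State.mem_nbrs, State.mem_nbrs, h, Finset.mem_insert]
    refine ⟨fun h1 => h1.resolve_left fun h2 => ?_, Or.inr⟩
    rw [Sym2.eq_iff] at h2
    rcases h2 with ⟨h2, -⟩ | ⟨h2, -⟩
    · exact hzx h2
    · exact hzy h2

/-- Breaker cannot claim two edges in one round. -/
lemma Round.not_mem_or (h : Round s w t) {e f : Sym2 (Fin n)} (hef : e ≠ f)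
    (he : e ∉ s.breakerEdges) (hf : f ∉ s.breakerEdges) :
    e ∉ t.breakerEdges ∨ f ∉ t.breakerEdges := by
  obtain ⟨x, y, h | ⟨-, h⟩⟩ := h.breakerEdges_eq
  · rw [h]; exact Or.inl he
  · rw [h, Finset.mem_insert, Finset.mem_insert]
    by_cases h1 : e = s(x, y)
    · right
      rintro (h2 | h2)
      · exact hef (h1.trans h2.symm)
      · exact hf h2
    · left
      rintro (h2 | h2)
      · exact h1 h2
      · exact he h2

end Round

/-! ### Detours from a tour -/

/-- A long list of distinct vertices contains three consecutive ones outside a small set. -/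
lemma exists_triple (l : List (Fin n)) (hl : l.Nodup) (S : Finset (Fin n))
    (h : 3 * (S.card + 1) ≤ l.length) :
    ∃ l₁ b v a l₂, l = l₁ ++ b :: v :: a :: l₂ ∧ b ∉ S ∧ v ∉ S ∧ a ∉ S := by
  obtain ⟨m, hm⟩ : ∃ m, S.card = m := ⟨_, rfl⟩
  induction m generalizing l S with
  | zero =>
    match l, h with
    | b :: v :: a :: l₂, _ =>
      have := Finset.card_eq_zero.1 hm
      exact ⟨[], b, v, a, l₂, rfl, by simp [this], by simp [this], by simp [this]⟩
    | [], h | [_], h | [_, _], h => simp at h; try omega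
  | succ m ih =>
    match l, hl, h with
    | b :: v :: a :: l₂, hl, h =>
      by_cases hS : b ∉ S ∧ v ∉ S ∧ a ∉ S
      · exact ⟨[], b, v, a, l₂, rfl, hS⟩
      · obtain ⟨y, hyS, hy⟩ : ∃ y ∈ S, y ∈ [b, v, a] := by
          by_contra! hcon
          exact hS ⟨fun h => hcon b h (by simp), fun h => hcon v h (by simp),
            fun h => hcon a h (by simp)⟩
        have hcard := Finset.card_erase_of_mem hyS
        have hl' : ([b, v, a] ++ l₂).Nodup := hl
        have hyl : y ∉ l₂ := fun h => (List.nodup_append.1 hl').2.2 y hy y h rfl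
        obtain ⟨l₁, b', v', a', l₃, rfl, h1, h2, h3⟩ := ih l₂ (List.nodup_append.1 hl').2.1
          (S.erase y) (by simp at h; omega) (by omega)
        have key : ∀ x ∈ l₁ ++ b' :: v' :: a' :: l₃, x ∉ S.erase y → x ∉ S := fun x hx h hxS =>
          h (Finset.mem_erase.2 ⟨fun hxy => hyl (hxy ▸ hx), hxS⟩)
        exact ⟨b :: v :: a :: l₁, b', v', a', l₃, rfl, key _ (by simp) h1, key _ (by simp) h2,
          key _ (by simp) h3⟩
    | [], _, h | [_], _, h | [_, _], _, h => simp at h; try omega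

lemma State.IsTour.exists_triple {s : State n} {v₀ : Fin n} {t₀ : List (Fin n)}
    (ht : s.IsTour v₀ t₀) (S : Finset (Fin n)) (h : 3 * (S.card + 1) ≤ (v₀ :: t₀).length) :
    ∃ v a b mid, s.IsTour v (a :: (mid ++ [b])) ∧
      (v :: a :: (mid ++ [b])).Perm (v₀ :: t₀) ∧ v ∉ S ∧ a ∉ S ∧ b ∉ S := by
  obtain ⟨l₁, b, v, a, l₂, he, hb, hv, ha⟩ := WalkerBreaker.exists_triple _ ht.nodup S h
  cases l₁ with
  | nil =>
    simp only [List.nil_append, List.cons.injEq] at he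
    obtain ⟨rfl, rfl⟩ := he
    have h1 := ht.rotate (l₁ := [])
    refine ⟨v, a, v₀, l₂, by simpa using h1, ?_, hv, ha, hb⟩
    have := List.perm_append_comm (l₁ := v :: a :: l₂) (l₂ := [v₀])
    simpa using this
  | cons x l₁ =>
    simp only [List.cons_append, List.cons.injEq] at he
    obtain ⟨rfl, rfl⟩ := he
    have h1 : s.IsTour v₀ ((l₁ ++ [b]) ++ v :: (a :: l₂)) := by simpa using ht
    refine ⟨v, a, b, l₂ ++ v₀ :: l₁, by simpa using h1.rotate, ?_, hv, ha, hb⟩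
    have := List.perm_append_comm (l₁ := v :: a :: l₂) (l₂ := v₀ :: (l₁ ++ [b]))
    simpa using this

/-- Walker has a tour starting with `v :: a :: mid ++ [b]`, and from its vertex `v` she has walked
along the vertices of `ws`, all of them off the tour; the last of them comes first in `ws`. -/
structure State.OnDetour (s : State n) (v a b : Fin n) (mid ws : List (Fin n)) : Prop where
  tour : s.IsTour v (a :: (mid ++ [b]))
  chain : (ws ++ [v]).IsChain s.WAdj
  nodup : (ws ++ v :: a :: (mid ++ [b])).Nodup
  head : (ws ++ [v]).head? = some s.pos

/-- The vertices of a tour together with those of a detour from it. -/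
def visited (v a b : Fin n) (mid ws : List (Fin n)) : Finset (Fin n) :=
  (ws ++ v :: a :: (mid ++ [b])).toFinset

lemma visited_cons (v a b w : Fin n) (mid ws : List (Fin n)) :
    visited v a b mid (w :: ws) = insert w (visited v a b mid ws) := by
  simp [visited]

lemma visited_subset_cons (v a b w : Fin n) (mid ws : List (Fin n)) :
    visited v a b mid ws ⊆ visited v a b mid (w :: ws) := by
  rw [visited_cons]; exact Finset.subset_insert _ _

lemma State.OnDetour.card_visited {s : State n} {v a b : Fin n} {mid ws : List (Fin n)}
    (h : s.OnDetour v a b mid ws) :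
    (visited v a b mid ws).card = ws.length + mid.length + 3 := by
  rw [visited, List.toFinset_card_of_nodup h.nodup]
  simp; omega

lemma State.OnDetour.pos_mem {s : State n} {v a b : Fin n} {mid ws : List (Fin n)}
    (h : s.OnDetour v a b mid ws) : s.pos ∈ visited v a b mid ws := by
  have h1 := List.mem_of_head? h.head
  simp only [visited, List.mem_toFinset, List.mem_append, List.mem_cons] at h1 ⊢
  simp at h1
  tauto

lemma State.OnDetour.a_ne_b {s : State n} {v a b : Fin n} {mid ws : List (Fin n)}
    (h : s.OnDetour v a b mid ws) : a ≠ b := by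
  have := h.tour.nodup
  simp at this
  tauto

lemma left_mem_visited (v a b : Fin n) (mid ws : List (Fin n)) : a ∈ visited v a b mid ws := by
  simp [visited]

lemma right_mem_visited (v a b : Fin n) (mid ws : List (Fin n)) : b ∈ visited v a b mid ws := by
  simp [visited]

lemma State.OnDetour.next {s t : State n} {v a b w : Fin n} {mid ws : List (Fin n)}
    (h : s.OnDetour v a b mid ws) (hw : w ∉ visited v a b mid ws) (hr : Round s w t) :
    t.OnDetour v a b mid (w :: ws) := by
  refine ⟨h.tour.mono hr.walkerEdges_subset, ?_, ?_, by simp [hr.pos_eq]⟩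
  · rw [List.cons_append, List.isChain_cons]
    refine ⟨fun y hy => ?_, h.chain.imp fun _ _ h => hr.walkerEdges_subset h⟩
    rw [h.head] at hy
    obtain rfl : s.pos = y := by simpa using hy
    exact hr.wadj.symm
  · rw [List.cons_append, List.nodup_cons]
    exact ⟨fun h1 => hw (List.mem_toFinset.2 h1), h.nodup⟩

lemma State.OnDetour.reverse {s : State n} {v a b : Fin n} {mid ws : List (Fin n)}
    (h : s.OnDetour v a b mid ws) : s.OnDetour v b a mid.reverse ws := by
  refine ⟨by simpa using h.tour.reverse, h.chain, ?_, h.head⟩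
  have hp : (ws ++ v :: b :: (mid.reverse ++ [a])).Perm (ws ++ v :: a :: (mid ++ [b])) := by
    have := (List.reverse_perm (a :: (mid ++ [b])))
    exact ((by simpa using this : (b :: (mid.reverse ++ [a])).Perm _).cons v).append_left ws
  exact hp.nodup_iff.2 h.nodup

lemma State.OnDetour.close {s t : State n} {v a b : Fin n} {mid ws : List (Fin n)}
    (h : s.OnDetour v a b mid ws) (hws : ws ≠ []) (hr : Round s b t) :
    ∃ v' t', t.IsTour v' t' ∧ (v' :: t').toFinset = visited v a b mid ws := by
  cases ws with
  | nil => exact absurd rfl hws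
  | cons w ws =>
    have hpos : s.pos = w := by simpa using h.head.symm
    have h1 := (h.tour.mono hr.walkerEdges_subset).insert_detour (t := a :: mid) (b := b) (w := w)
      (ws := ws) (h.chain.imp fun _ _ h => hr.walkerEdges_subset h) (by simpa using h.nodup)
      (hpos ▸ hr.wadj.symm)
    exact ⟨_, _, h1, by simp [visited]⟩

lemma visited_reverse (v a b : Fin n) (mid ws : List (Fin n)) :
    visited v b a mid.reverse ws = visited v a b mid ws := by
  ext x; simp [visited]; tauto

/-- Walker closes a detour by walking to a neighbour of its starting vertex `v` on the tour. Both
neighbours will do, as a tour can be traversed in both directions. -/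
lemma State.OnDetour.exists_close {s : State n} {v a b : Fin n} {mid ws : List (Fin n)}
    (h : s.OnDetour v a b mid ws) (hws : ws ≠ [])
    (hgate : s(s.pos, a) ∉ s.breakerEdges ∨ s(s.pos, b) ∉ s.breakerEdges) :
    ∃ y, (y = a ∨ y = b) ∧ s.CanWalkTo y ∧ ∀ t, Round s y t →
      ∃ v' t', t.IsTour v' t' ∧ (v' :: t').toFinset = visited v a b mid ws := by
  have hpos : s.pos ∉ v :: a :: (mid ++ [b]) := by
    cases ws with
    | nil => exact absurd rfl hws
    | cons w ws =>
      have hpos : s.pos = w := by simpa using h.head.symm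
      rw [hpos]
      have := h.nodup
      rw [List.cons_append, List.nodup_cons, List.mem_append] at this
      exact fun h => this.1 (Or.inr h)
  rcases hgate with hg | hg
  · refine ⟨a, Or.inl rfl, ⟨fun he => hpos (by simp [he]), hg⟩, fun t hr => ?_⟩
    obtain ⟨v', t', h1, h2⟩ := h.reverse.close hws hr
    exact ⟨v', t', h1, h2.trans (visited_reverse _ _ _ _ _)⟩
  · exact ⟨b, Or.inr rfl, ⟨fun he => hpos (by simp [he]), hg⟩, fun t hr => h.close hws hr⟩

/-! ### Long detours and the pursuit of a vertex -/

/-- All vertices outside `X` have degree at most `G` in Breaker's graph. -/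
def State.Calm (s : State n) (X : Finset (Fin n)) (G : ℕ) : Prop := ∀ z ∉ X, s.deg z ≤ G

/-- The vertex `u` outside `X` has degree at least `h` in Breaker's graph, but at most `G` of his
edges join it to other vertices outside `X`, whose own degrees are at most `G`. -/
structure State.Pursued (s : State n) (X : Finset (Fin n)) (u : Fin n) (h G : ℕ) : Prop where
  not_mem : u ∉ X
  high : h ≤ s.deg u
  out_le : (s.nbrs u \ X).card ≤ G
  others : ∀ z ∉ X, z ≠ u → s.deg z ≤ G

lemma State.Calm.mono {s : State n} {X : Finset (Fin n)} {G G' : ℕ} (h : s.Calm X G)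
    (hG : G ≤ G') : s.Calm X G' := fun z hz => (h z hz).trans hG

lemma State.Pursued.mono {s : State n} {X : Finset (Fin n)} {u : Fin n} {h G G' : ℕ}
    (hp : s.Pursued X u h G) (hG : G ≤ G') : s.Pursued X u h G' :=
  ⟨hp.not_mem, hp.high, hp.out_le.trans hG, fun z hz hzu => (hp.others z hz hzu).trans hG⟩

lemma State.Calm.next {s t : State n} {w : Fin n} {X Y : Finset (Fin n)} {G : ℕ}
    (h : s.Calm X G) (hr : Round s w t) (hXY : X ⊆ Y) : t.Calm Y (G + 1) := fun z hz =>
  (hr.deg_le z).trans (Nat.succ_le_succ (h z fun h => hz (hXY h)))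

lemma State.Pursued.next {s t : State n} {w u : Fin n} {X Y : Finset (Fin n)} {h G : ℕ}
    (hp : s.Pursued X u h G) (hr : Round s w t) (hXY : X ⊆ Y) (hu : u ∉ Y) :
    t.Pursued Y u h (G + 1) :=
  ⟨hu, hp.high.trans (hr.deg_mono u), (hr.outDeg_le u hXY).trans (Nat.succ_le_succ hp.out_le),
    fun z hz hzu =>
      (hr.deg_le z).trans (Nat.succ_le_succ (hp.others z (fun h => hz (hXY h)) hzu))⟩

/-- If Breaker answers Walker's move to `w` by claiming the edge `wu`, the bounds do not change. -/
lemma State.Pursued.next_of_guard {s t : State n} {w u : Fin n} {X : Finset (Fin n)} {h G : ℕ}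
    (hp : s.Pursued X u h G) (hr : Round s w t) (hwu : w ≠ u) (hs : s(w, u) ∉ s.breakerEdges)
    (ht : s(w, u) ∈ t.breakerEdges) : t.Pursued (insert w X) u h G := by
  refine ⟨?_, hp.high.trans (hr.deg_mono u), ?_, fun z hz hzu => ?_⟩
  · rw [Finset.mem_insert]
    rintro (rfl | h)
    · exact hwu rfl
    · exact hp.not_mem h
  · refine (Finset.card_le_card fun z hz => ?_).trans hp.out_le
    rw [Finset.mem_sdiff, Finset.mem_insert, not_or] at hz
    obtain ⟨hz, hzw, hzX⟩ := hz
    refine Finset.mem_sdiff.2 ⟨?_, hzX⟩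
    by_contra hcon
    rw [State.mem_nbrs] at hz hcon
    have hne : s(w, u) ≠ s(u, z) := by
      rw [Sym2.eq_swap]
      exact fun he => hzw (Sym2.congr_right.1 he).symm
    exact (hr.not_mem_or hne hs hcon).elim (fun h1 => h1 ht) fun h1 => h1 hz
  · rw [Finset.mem_insert, not_or] at hz
    rw [State.deg, hr.nbrs_eq hs ht hz.1 hzu]
    exact hp.others z hz.2 hzu

/-- Walker is on a detour, and some counts are bounded: the degrees in Breaker's graph of the two
neighbours `a` and `b` of its starting vertex on the tour by `A`, the number of Breaker's edges by
`M`, and from below the number of visited vertices of degree at least `h` by `q`. -/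
structure State.Underway (s : State n) (v a b : Fin n) (mid ws : List (Fin n)) (h A M q : ℕ) :
    Prop extends s.OnDetour v a b mid ws where
  deg_a : s.deg a ≤ A
  deg_b : s.deg b ≤ A
  card_le : s.breakerEdges.card ≤ M
  le_highCount : q ≤ s.highCount h (visited v a b mid ws)

/-- Walker can close her detour in one move. -/
def State.CanClose (s : State n) (a b : Fin n) : Prop :=
  s(s.pos, a) ∉ s.breakerEdges ∨ s(s.pos, b) ∉ s.breakerEdges

section Underway

variable {s t : State n} {v a b w u : Fin n} {mid ws : List (Fin n)} {h A M q : ℕ}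

lemma State.Underway.next (hs : s.Underway v a b mid ws h A M q) (hw : w ∉ visited v a b mid ws)
    (hr : Round s w t) : t.Underway v a b mid (w :: ws) h (A + 1) (M + 1) q :=
  ⟨hs.toOnDetour.next hw hr, (hr.deg_le a).trans (Nat.succ_le_succ hs.deg_a),
    (hr.deg_le b).trans (Nat.succ_le_succ hs.deg_b),
    hr.card_le.trans (Nat.succ_le_succ hs.card_le),
    hs.le_highCount.trans (hr.highCount_mono h (visited_subset_cons v a b w mid ws))⟩

lemma State.Underway.next_high (hs : s.Underway v a b mid ws h A M q)
    (hw : w ∉ visited v a b mid ws) (hd : h ≤ s.deg w) (hr : Round s w t) :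
    t.Underway v a b mid (w :: ws) h (A + 1) (M + 1) (q + 1) := by
  refine { hs.next hw hr with le_highCount := ?_ }
  have h1 : s.highCount h (insert w (visited v a b mid ws))
      = s.highCount h (visited v a b mid ws) + 1 := by
    rw [State.highCount, Finset.filter_insert, if_pos hd, Finset.card_insert_of_notMem]
    · rfl
    · simp [hw]
  have h2 := hr.highCount_mono h (Finset.Subset.refl (insert w (visited v a b mid ws)))
  have h3 := hs.le_highCount
  rw [visited_cons]
  omega

lemma State.Underway.canClose_next (hs : s.Underway v a b mid ws h A M q) (hr : Round s w t)
    (ha : s(w, a) ∉ s.breakerEdges) (hb : s(w, b) ∉ s.breakerEdges) : t.CanClose a b := by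
  rw [State.CanClose, hr.pos_eq]
  exact hr.not_mem_or (fun h => hs.a_ne_b (Sym2.congr_right.1 h)) ha hb

lemma State.Underway.exists_next (hs : s.Underway v a b mid ws h A M q) (E : Finset (Fin n))
    (hcard : (visited v a b mid ws).card + (s.nbrs s.pos \ visited v a b mid ws).card + 2 * A
      + (E \ visited v a b mid ws).card < n) :
    ∃ w ∉ visited v a b mid ws, w ∉ E ∧ s.CanWalkTo w ∧ s(w, a) ∉ s.breakerEdges ∧
      s(w, b) ∉ s.breakerEdges := by
  set X := visited v a b mid ws
  have h1 : (X ∪ (s.nbrs s.pos \ X) ∪ s.nbrs a ∪ s.nbrs b ∪ (E \ X)).card < n := by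
    have e1 := Finset.card_union_le (X ∪ (s.nbrs s.pos \ X) ∪ s.nbrs a ∪ s.nbrs b) (E \ X)
    have e2 := Finset.card_union_le (X ∪ (s.nbrs s.pos \ X) ∪ s.nbrs a) (s.nbrs b)
    have e3 := Finset.card_union_le (X ∪ (s.nbrs s.pos \ X)) (s.nbrs a)
    have e4 := Finset.card_union_le X (s.nbrs s.pos \ X)
    have e5 := hs.deg_a
    have e6 := hs.deg_b
    unfold State.deg at e5 e6
    omega
  obtain ⟨w, hw⟩ : ∃ w, w ∉ X ∪ (s.nbrs s.pos \ X) ∪ s.nbrs a ∪ s.nbrs b ∪ (E \ X) := by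
    by_contra! hcon
    rw [Finset.eq_univ_iff_forall.2 hcon, Finset.card_univ, Fintype.card_fin] at h1
    exact lt_irrefl _ h1
  simp only [Finset.mem_union, Finset.mem_sdiff, not_or, not_and, not_not, State.mem_nbrs'] at hw
  obtain ⟨⟨⟨⟨hX, hp⟩, ha⟩, hb⟩, hE⟩ := hw
  refine ⟨w, hX, fun h => hX (hE h), ⟨fun h => hX (h ▸ hs.pos_mem), fun h => hX (hp ?_)⟩, ha, hb⟩
  rwa [Sym2.eq_swap]

/-- When no vertex is pursued, Walker prolongs her detour by `j` unvisited vertices. All counts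
grow by at most one per round. -/
lemma force_detour (Z j : ℕ) (s : State n) (v a b : Fin n) (mid ws : List (Fin n))
    (h A M q G : ℕ) (hs : s.Underway v a b mid ws h A M q)
    (hG : s.Calm (visited v a b mid ws) G)
    (hpos : (s.nbrs s.pos \ visited v a b mid ws).card ≤ Z)
    (hclose : j = 0 → s.CanClose a b) (hGZ : G + j ≤ Z)
    (hcard : (visited v a b mid ws).card + j + Z + 2 * (A + j) < n) :
    Force (fun t => ∃ ws', ws'.length = ws.length + j ∧
      t.Underway v a b mid ws' h (A + j) (M + j) q ∧ t.CanClose a b ∧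
      t.Calm (visited v a b mid ws') (G + j)) s := by
  induction j generalizing s ws A M G with
  | zero => exact Force.done ⟨ws, rfl, hs, hclose rfl, hG⟩
  | succ j ih =>
    obtain ⟨w, hwX, -, hwalk, hwa, hwb⟩ := hs.exists_next ∅ (by simp; omega)
    refine Force.round w hwalk fun t hr => ?_
    have hcX : (visited v a b mid (w :: ws)).card = (visited v a b mid ws).card + 1 := by
      rw [visited_cons, Finset.card_insert_of_notMem hwX]
    have hG' := hG.next hr (visited_subset_cons v a b w mid ws)
    refine (ih t (w :: ws) (A + 1) (M + 1) (G + 1) (hs.next hwX hr) hG' ?_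
      (fun _ => hs.canClose_next hr hwa hwb) (by omega) (by omega)).mono ?_
    · refine (Finset.card_le_card Finset.sdiff_subset).trans ?_
      have h1 := hr.deg_le w
      have h2 := hG w hwX
      rw [hr.pos_eq]
      exact h1.trans (by omega)
    · rintro t' ⟨ws', h1, h2, h3, h4⟩
      rw [show A + 1 + j = A + (j + 1) by omega, show M + 1 + j = M + (j + 1) by omega] at h2
      rw [show G + 1 + j = G + (j + 1) by omega] at h4
      exact ⟨ws', by simp at h1; omega, h2, h3, h4⟩

/-- When `u` is pursued, Walker prolongs her detour by `j` unvisited vertices which are not joined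
to `u` by Breaker. In each round he must claim the edge between her position and `u`, for otherwise
she walks to `u`. So either she visits `u`, or the degrees of the other unvisited vertices hardly
change. -/
lemma force_pursuit (Z j : ℕ) (s : State n) (v a b u : Fin n) (mid ws : List (Fin n))
    (h A M q G : ℕ) (hs : s.Underway v a b mid ws h A M q)
    (hG : s.Pursued (visited v a b mid ws) u h G)
    (hpos : (s.nbrs s.pos \ visited v a b mid ws).card ≤ Z)
    (hclose : j = 0 → s.CanClose a b) (hGZ : G + 2 + j ≤ Z)
    (hcard : (visited v a b mid ws).card + j + 2 * Z + 2 * (A + j) < n) :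
    Force (fun t => ∃ ws', ws'.length = ws.length + j ∧
      t.CanClose a b ∧
      ((t.Underway v a b mid ws' h (A + j) (M + j) q ∧
          t.Pursued (visited v a b mid ws') u h (G + 2)) ∨
        (t.Underway v a b mid ws' h (A + j) (M + j) (q + 1) ∧
          t.Calm (visited v a b mid ws') (G + j)))) s := by
  induction j generalizing s ws A M G with
  | zero => exact Force.done ⟨ws, rfl, hclose rfl, Or.inl ⟨hs, hG.mono (by omega)⟩⟩
  | succ j ih =>
    have hfresh : ∀ (s : State n) (ws : List (Fin n)) (A M G : ℕ),
        s.Underway v a b mid ws h A M q → s.Pursued (visited v a b mid ws) u h G →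
        (s.nbrs s.pos \ visited v a b mid ws).card ≤ Z → G + 1 ≤ Z →
        (visited v a b mid ws).card + 2 * Z + 2 * A < n →
        ∃ w ∉ visited v a b mid ws, w ≠ u ∧ s(w, u) ∉ s.breakerEdges ∧ s.CanWalkTo w ∧
          s(w, a) ∉ s.breakerEdges ∧ s(w, b) ∉ s.breakerEdges := by
      intro s ws A M G hs hG hpos hGZ hcard
      have hE : (insert u (s.nbrs u) \ visited v a b mid ws).card ≤ G + 1 := by
        rw [Finset.insert_sdiff_of_notMem _ hG.not_mem]
        exact (Finset.card_insert_le _ _).trans (Nat.succ_le_succ hG.out_le)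
      obtain ⟨w, h1, h2, h3, h4, h5⟩ := hs.exists_next (insert u (s.nbrs u)) (by omega)
      rw [Finset.mem_insert, not_or, State.mem_nbrs'] at h2
      exact ⟨w, h1, h2.1, h2.2, h3, h4, h5⟩
    have hlight : ∀ (s t : State n) (w : Fin n) (X Y : Finset (Fin n)) (G : ℕ),
        s.Pursued X u h G → w ∉ X → w ≠ u → Round s w t → G + 1 ≤ Z →
        (t.nbrs t.pos \ Y).card ≤ Z := by
      intro s t w X Y G hG hwX hwu hr hGZ
      refine (Finset.card_le_card Finset.sdiff_subset).trans ?_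
      have h1 := hr.deg_le w
      have h2 := hG.others w hwX hwu
      rw [hr.pos_eq]
      exact h1.trans (by omega)
    obtain ⟨w, hwX, hwu, hwu', hwalk, hwa, hwb⟩ :=
      hfresh s ws A M G hs hG hpos (by omega) (by omega)
    refine Force.round w hwalk fun t hr => ?_
    have hcX : (visited v a b mid (w :: ws)).card = (visited v a b mid ws).card + 1 := by
      rw [visited_cons, Finset.card_insert_of_notMem hwX]
    have hs1 := hs.next hwX hr
    have hpos1 := hlight s t w _ (visited v a b mid (w :: ws)) G hG hwX hwu hr (by omega)
    have hc1 := hs.canClose_next hr hwa hwb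
    by_cases hguard : s(w, u) ∈ t.breakerEdges
    · have hG1 := hG.next_of_guard hr hwu hwu' hguard
      rw [← visited_cons] at hG1
      refine (ih t (w :: ws) (A + 1) (M + 1) G hs1 hG1 hpos1 (fun _ => hc1) (by omega)
        (by omega)).mono ?_
      rintro t' ⟨ws', h1, h2, h3⟩
      rw [show A + 1 + j = A + (j + 1) by omega, show M + 1 + j = M + (j + 1) by omega] at h3
      refine ⟨ws', by simp at h1; omega, h2, h3.imp id fun h4 => ⟨h4.1, h4.2.mono (by omega)⟩⟩
    · have huX : u ∉ visited v a b mid (w :: ws) := by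
        rw [visited_cons, Finset.mem_insert, not_or]
        exact ⟨hwu.symm, hG.not_mem⟩
      have hG1 := hG.next hr (visited_subset_cons v a b w mid ws) huX
      rcases j with _ | _ | j
      · exact Force.done ⟨w :: ws, rfl, hc1, Or.inl ⟨hs1, hG1.mono (by omega)⟩⟩
      · -- visiting `u` in the last round might make it impossible to close the detour
        obtain ⟨w', hwX', hwu'', -, hwalk', hwa', hwb'⟩ :=
          hfresh t (w :: ws) (A + 1) (M + 1) (G + 1) hs1 hG1 hpos1 (by omega) (by omega)
        refine Force.round w' hwalk' fun t' hr' => Force.done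
          ⟨w' :: w :: ws, rfl, hs1.canClose_next hr' hwa' hwb', Or.inl ⟨hs1.next hwX' hr', ?_⟩⟩
        refine hG1.next hr' (visited_subset_cons v a b w' mid (w :: ws)) ?_
        rw [visited_cons, Finset.mem_insert, not_or]
        exact ⟨hwu''.symm, huX⟩
      · have hwalku : t.CanWalkTo u := by
          rw [State.CanWalkTo, hr.pos_eq]
          exact ⟨hwu, hguard⟩
        refine Force.round u hwalku fun t' hr' => ?_
        have hcX' : (visited v a b mid (u :: w :: ws)).card = (visited v a b mid ws).card + 2 := by
          rw [visited_cons, Finset.card_insert_of_notMem huX, hcX]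
        have hs2 := hs1.next_high huX hG1.high hr'
        have hG2 : t'.Calm (visited v a b mid (u :: w :: ws)) (G + 2) := by
          intro z hz
          rw [visited_cons, Finset.mem_insert, not_or] at hz
          exact (hr'.deg_le z).trans (Nat.succ_le_succ (hG1.others z hz.2 hz.1))
        refine (force_detour Z (j + 1) t' v a b mid (u :: w :: ws) h (A + 2) (M + 2) (q + 1)
          (G + 2) hs2 hG2 ?_ (by simp) (by omega) (by omega)).mono ?_
        · rw [hr'.pos_eq]
          have h1 := hr'.outDeg_le u (visited_subset_cons v a b u mid (w :: ws))
          have h2 := hG1.out_le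
          omega
        · rintro t'' ⟨ws', h1, h2, h3, h4⟩
          rw [show A + 2 + (j + 1) = A + (j + 1 + 1 + 1) by omega,
            show M + 2 + (j + 1) = M + (j + 1 + 1 + 1) by omega] at h2
          exact ⟨ws', by simp at h1; omega, h3, Or.inr ⟨h2, h4.mono (by omega)⟩⟩

end Underway

/-! ### Enlarging a tour -/

/-- Walker has a tour with vertex set `X` and stands at one of its vertices, whose degree in
Breaker's graph is at most `D`; Breaker has at most `M` edges. -/
structure State.Touring (s : State n) (X : Finset (Fin n)) (D M : ℕ) : Prop where
  exists_tour : ∃ v t, s.IsTour v t ∧ (v :: t).toFinset = X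
  pos_mem : s.pos ∈ X
  deg_pos : s.deg s.pos ≤ D
  card_le : s.breakerEdges.card ≤ M

/-- The vertices of degree at least `1000 * k` in Breaker's graph. -/
def State.heavy (s : State n) (k : ℕ) : Finset (Fin n) :=
  Finset.univ.filter fun z => 1000 * k ≤ s.deg z

lemma State.card_heavy_le {s : State n} {k : ℕ} (hk : 1000000 ≤ k) (hn : n ≤ 1000001 * k)
    (hB : s.breakerEdges.card ≤ 3 * n) : (s.heavy k).card ≤ k := by
  have h1 : (s.heavy k).card * (1000 * k) ≤ 2 * s.breakerEdges.card :=
    s.highCount_mul_le (1000 * k) Finset.univ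
  by_contra! hcon
  have h2 : k * (1000 * k) ≤ (s.heavy k).card * (1000 * k) := Nat.mul_le_mul_right _ hcon.le
  have h3 : 1000000 * (1000 * k) ≤ k * (1000 * k) := Nat.mul_le_mul_right _ hk
  omega

/-- Walker moves to a vertex `v` of her tour such that neither `v` nor its two neighbours on the
tour belong to a given small set `S`. -/
lemma State.Touring.exists_hop {s : State n} {X : Finset (Fin n)} {D M : ℕ}
    (hs : s.Touring X D M) (S : Finset (Fin n)) (hpos : s.pos ∈ S) (hnbrs : s.nbrs s.pos ⊆ S)
    (hcard : 3 * (S.card + 1) ≤ X.card) :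
    ∃ v a b mid, s.CanWalkTo v ∧ v ∉ S ∧ a ∉ S ∧ b ∉ S ∧ visited v a b mid [] = X ∧
      ∀ t, Round s v t → t.OnDetour v a b mid [] := by
  obtain ⟨v₀, t₀, ht, hX⟩ := hs.exists_tour
  have hlen : X.card = (v₀ :: t₀).length := by
    rw [← hX, List.toFinset_card_of_nodup ht.nodup]
  obtain ⟨v, a, b, mid, h1, h2, hv, ha, hb⟩ := ht.exists_triple S (hlen ▸ hcard)
  refine ⟨v, a, b, mid, ⟨fun h => hv (h ▸ hpos), fun h => hv (hnbrs (State.mem_nbrs.2 h))⟩,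
    hv, ha, hb, ?_, fun t hr => ⟨h1.mono hr.walkerEdges_subset, by simp, ?_, by simp [hr.pos_eq]⟩⟩
  · rw [← hX]
    exact List.toFinset_eq_of_perm _ _ h2
  · simpa using h1.nodup

lemma State.OnDetour.force_close {s : State n} {v a b : Fin n} {mid ws : List (Fin n)} {A M : ℕ}
    (hs : s.OnDetour v a b mid ws) (hws : ws ≠ []) (hc : s.CanClose a b)
    (ha : s.deg a ≤ A) (hb : s.deg b ≤ A) (hM : s.breakerEdges.card ≤ M) {P : State n → Prop}
    (hP : ∀ y t, Round s y t → t.Touring (visited v a b mid ws) (A + 1) (M + 1) → Force P t) :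
    Force P s := by
  obtain ⟨y, hy, hwalk, htour⟩ := hs.exists_close hws hc
  refine Force.round y hwalk fun t hr => hP y t hr ⟨htour t hr, ?_, ?_, ?_⟩
  · rw [hr.pos_eq]
    rcases hy with rfl | rfl
    · exact left_mem_visited _ _ _ _ _
    · exact right_mem_visited _ _ _ _ _
  · rw [hr.pos_eq]
    refine (hr.deg_le y).trans (Nat.succ_le_succ ?_)
    rcases hy with rfl | rfl
    · exact ha
    · exact hb
  · exact hr.card_le.trans (Nat.succ_le_succ hM)

/-- The invariant while many vertices are off the tour, whose length is `m`. Here `i` counts the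
detours made so far, and at least `q` vertices of degree `5000 * k` or more have been visited. The
bound `G`, which holds for the degrees of all vertices off the tour except possibly a pursued one,
grows by at most `5` in a detour that leaves the pursued vertex unvisited, and by at most `k + 5` in
one that visits it and so increases `q`. As Breaker has at most `2 * n` edges, `q` is bounded by a
constant, and so `G` is small compared with `n`. -/
def State.Growing (s : State n) (k m : ℕ) : Prop :=
  ∃ X i q G, X.card = m ∧ s.Touring X (1002 * k) (2 * m) ∧ i * k ≤ m ∧
    q ≤ s.highCount (5000 * k) X ∧ G ≤ 5000 * k + (k + 5) * (q + 1) + 5 * i ∧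
    (s.Calm X G ∨ ∃ u, s.Pursued X u (5000 * k) G)

/-- The bound `G` in `State.Growing` is of order `5000 * k`, since `q` and `i` are bounded by constants
and `k` is large. -/
lemma growing_bound {s : State n} {k m i q G : ℕ} {X : Finset (Fin n)} (hk : 1000000 ≤ k)
    (hn : n ≤ 1000001 * k) (hm : m ≤ n) (hB : s.breakerEdges.card ≤ 2 * m) (hi : i * k ≤ m)
    (hq : q ≤ s.highCount (5000 * k) X) (hG : G ≤ 5000 * k + (k + 5) * (q + 1) + 5 * i) :
    G ≤ 6000 * k := by
  have h1 := s.highCount_mul_le (5000 * k) X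
  have h2 : q ≤ 900 := by
    by_contra! hcon
    have h3 : 901 * (5000 * k) ≤ s.highCount (5000 * k) X * (5000 * k) :=
      Nat.mul_le_mul_right _ (by omega)
    omega
  have h4 : i ≤ 1000001 := by
    by_contra! hcon
    have h3 : 1000002 * k ≤ i * k := Nat.mul_le_mul_right _ (by omega)
    omega
  have h5 : (k + 5) * (q + 1) ≤ (k + 5) * 901 := Nat.mul_le_mul_left _ (by omega)
  omega

/-- While many vertices are off the tour, Walker can enlarge it by a detour through `k` of them. If
one of them has high degree, she pursues it during the detour. -/
lemma State.Growing.step {s : State n} {k m : ℕ} (hk : 1000000 ≤ k) (hn : n ≤ 1000001 * k)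
    (hm0 : 3900 * k ≤ m) (hm : m + 16000 * k ≤ n) (hs : s.Growing k m) :
    Force (fun t => t.Growing k (m + k)) s := by
  obtain ⟨X, i, q, G, hXm, hT, hi, hq, hG, hcases⟩ := hs
  have hGk := growing_bound hk hn (by omega) hT.card_le hi hq hG
  have hheavy := s.card_heavy_le hk hn (hT.card_le.trans (by omega))
  have hi' : (i + 1) * k ≤ m + k := by rw [Nat.add_mul, Nat.one_mul]; omega
  obtain ⟨v, a, b, mid, hwalk, hv, ha, hb, hvis, hround⟩ :=
    hT.exists_hop (insert s.pos (s.nbrs s.pos) ∪ s.heavy k) (by simp)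
      (fun z hz => by simp [hz]) (by
        have h1 := Finset.card_union_le (insert s.pos (s.nbrs s.pos)) (s.heavy k)
        have h2 := Finset.card_insert_le s.pos (s.nbrs s.pos)
        have h3 : (s.nbrs s.pos).card ≤ 1002 * k := hT.deg_pos
        omega)
  have hlight : ∀ z, z ∉ insert s.pos (s.nbrs s.pos) ∪ s.heavy k → s.deg z < 1000 * k := by
    intro z hz
    by_contra! hcon
    exact hz (Finset.mem_union_right _ (by simpa [State.heavy] using hcon))
  refine Force.round v hwalk fun t hr => ?_
  have hU : t.Underway v a b mid [] (5000 * k) (1000 * k) (2 * m + 1) q := by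
    refine ⟨hround t hr, (hr.deg_le a).trans (hlight a ha), (hr.deg_le b).trans (hlight b hb),
      hr.card_le.trans (Nat.succ_le_succ hT.card_le), hq.trans ?_⟩
    rw [hvis]
    exact hr.highCount_mono _ (Finset.Subset.refl X)
  have hpos : (t.nbrs t.pos \ visited v a b mid []).card ≤ 6010 * k := by
    refine (Finset.card_le_card Finset.sdiff_subset).trans ?_
    rw [hr.pos_eq]
    have h1 := (hr.deg_le v).trans (hlight v hv)
    exact h1.trans (by omega)
  have hvcard : (visited v a b mid []).card = m := by rw [hvis, hXm]
  have hlen : ∀ {t : State n} {ws' : List (Fin n)} {A M q' : ℕ},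
      t.Underway v a b mid ws' (5000 * k) A M q' → ws'.length = ([] : List (Fin n)).length + k →
      (visited v a b mid ws').card = m + k := by
    intro t ws' A M q' h1 h2
    have h3 := h1.card_visited
    have h4 := hU.card_visited
    simp at h2 h4
    omega
  have hne : ∀ {ws' : List (Fin n)}, ws'.length = ([] : List (Fin n)).length + k → ws' ≠ [] := by
    rintro ws' h1 rfl
    simp at h1
    omega
  -- only the case without a vertex of high degree and the case of a pursued vertex remain
  have hcases' : s.Calm X (5000 * k) ∨ ∃ u, s.Pursued X u (5000 * k) G := by
    rcases hcases with h | h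
    · by_cases hex : ∃ u ∉ X, 5000 * k ≤ s.deg u
      · obtain ⟨u, hu, hd⟩ := hex
        exact Or.inr ⟨u, hu, hd, (Finset.card_le_card Finset.sdiff_subset).trans (h u hu),
          fun z hz _ => h z hz⟩
      · push Not at hex
        exact Or.inl fun z hz => (hex z hz).le
    · exact Or.inr h
  rcases hcases' with hcalm | ⟨u, hu⟩
  · have hcalm' := hcalm.next hr (Finset.Subset.refl X)
    refine (force_detour (6010 * k) k t v a b mid [] (5000 * k) (1000 * k) (2 * m + 1) q
      (5000 * k + 1) hU (hvis ▸ hcalm') hpos (by omega) (by omega) (by omega)).bind ?_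
    rintro t₁ ⟨ws', h1, h2, h3, h4⟩
    refine h2.force_close (hne h1) h3 h2.deg_a h2.deg_b h2.card_le fun y t₂ hr₂ hT₂ =>
      Force.done ⟨visited v a b mid ws', i + 1, q, 5000 * k + 1 + k + 1, hlen h2 h1,
        ⟨hT₂.exists_tour, hT₂.pos_mem, hT₂.deg_pos.trans (by omega),
          hT₂.card_le.trans (by omega)⟩, hi',
        h2.le_highCount.trans (hr₂.highCount_mono _ (Finset.Subset.refl _)), ?_,
        Or.inl (h4.next hr₂ (Finset.Subset.refl _))⟩
    have : (k + 5) * 1 ≤ (k + 5) * (q + 1) := Nat.mul_le_mul_left _ (by omega)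
    omega
  · have hu' := hu.next hr (Finset.Subset.refl X) hu.not_mem
    refine (force_pursuit (6010 * k) k t v a b u mid [] (5000 * k) (1000 * k) (2 * m + 1) q
      (G + 1) hU (hvis ▸ hu') hpos (by omega) (by omega) (by omega)).bind ?_
    rintro t₁ ⟨ws', h1, h2, ⟨h3, h4⟩ | ⟨h3, h4⟩⟩
    · refine h3.force_close (hne h1) h2 h3.deg_a h3.deg_b h3.card_le fun y t₂ hr₂ hT₂ =>
        Force.done ⟨visited v a b mid ws', i + 1, q, G + 1 + 2 + 1, hlen h3 h1,
          ⟨hT₂.exists_tour, hT₂.pos_mem, hT₂.deg_pos.trans (by omega),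
            hT₂.card_le.trans (by omega)⟩, hi',
          h3.le_highCount.trans (hr₂.highCount_mono _ (Finset.Subset.refl _)), by omega,
          Or.inr ⟨u, h4.next hr₂ (Finset.Subset.refl _) h4.not_mem⟩⟩
    · refine h3.force_close (hne h1) h2 h3.deg_a h3.deg_b h3.card_le fun y t₂ hr₂ hT₂ =>
        Force.done ⟨visited v a b mid ws', i + 1, q + 1, G + 1 + k + 1, hlen h3 h1,
          ⟨hT₂.exists_tour, hT₂.pos_mem, hT₂.deg_pos.trans (by omega),
            hT₂.card_le.trans (by omega)⟩, hi',
          h3.le_highCount.trans (hr₂.highCount_mono _ (Finset.Subset.refl _)), ?_,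
          Or.inl (h4.next hr₂ (Finset.Subset.refl _))⟩
      have : (k + 5) * (q + 1 + 1) = (k + 5) * (q + 1) + (k + 5) := by ring
      omega

/-- The invariant while the tour, of length `m`, is enlarged by one vertex at a time: all vertices
off the tour but `u` have low degree, with room for three more edges per remaining vertex. -/
def State.Finishing (s : State n) (k m : ℕ) : Prop :=
  ∃ X u, X.card = m ∧ s.Touring X (1002 * k) (3 * m) ∧
    ∀ z ∉ X, z ≠ u → s.deg z + 3 * (n - m) ≤ 60000 * k

lemma State.Growing.finishing {s : State n} {k m : ℕ} (hk : 1000000 ≤ k) (hn : n ≤ 1000001 * k)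
    (hmn : m ≤ n) (hm : n ≤ m + 16000 * k) (hs : s.Growing k m) : s.Finishing k m := by
  obtain ⟨X, i, q, G, hXm, hT, hi, hq, hG, hcases⟩ := hs
  have hGk := growing_bound hk hn hmn hT.card_le hi hq hG
  have hT' : s.Touring X (1002 * k) (3 * m) :=
    ⟨hT.exists_tour, hT.pos_mem, hT.deg_pos, hT.card_le.trans (by omega)⟩
  rcases hcases with h | ⟨u, hu⟩
  · refine ⟨X, s.pos, hXm, hT', fun z hz _ => ?_⟩
    have := h z hz
    omega
  · refine ⟨X, u, hXm, hT', fun z hz hzu => ?_⟩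
    have := hu.others z hz hzu
    omega

lemma force_finishing {k : ℕ} (hk : 1000000 ≤ k) (hn : n ≤ 1000001 * k) (hn' : 1000000 * k ≤ n)
    (r : ℕ) : ∀ (s : State n) (m : ℕ), m + r = n → 3900 * k ≤ m → 3 ≤ r → s.Growing k m →
      Force (fun t => ∃ m, m + 3 ≤ n ∧ 900000 * k ≤ m ∧ t.Finishing k m) s := by
  induction r using Nat.strong_induction_on with
  | _ r ih =>
    intro s m hmr hm hr hs
    by_cases h : m + 16000 * k ≤ n
    · refine (hs.step hk hn hm h).bind fun t ht => ?_
      exact ih (r - k) (by omega) t (m + k) (by omega) (by omega) (by omega) ht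
    · exact Force.done ⟨m, by omega, by omega, hs.finishing hk hn (by omega) (by omega)⟩

/-- If two vertices `x` and `y` are joined by Breaker to none of the vertices in `T` before a round,
then this remains true of one of them. -/
lemma Round.free_or {s t : State n} {w x y : Fin n} (hr : Round s w t) {T : Finset (Fin n)}
    (hxy : x ≠ y) (hxT : x ∉ T) (hx : ∀ z ∈ T, z ∉ s.nbrs x) (hy : ∀ z ∈ T, z ∉ s.nbrs y) :
    (∀ z ∈ T, z ∉ t.nbrs x) ∨ ∀ z ∈ T, z ∉ t.nbrs y := by
  by_contra! hcon
  obtain ⟨⟨p, hp, hp'⟩, q, hq, hq'⟩ := hcon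
  have h1 := hx p hp
  have h2 := hy q hq
  rw [State.mem_nbrs] at h1 h2 hp' hq'
  have hne : s(x, p) ≠ s(y, q) := by
    intro he
    rw [Sym2.eq_iff] at he
    rcases he with ⟨h, -⟩ | ⟨h, -⟩
    · exact hxy h
    · exact hxT (h ▸ hq)
  exact (hr.not_mem_or hne h1 h2).elim (fun h => h hp') fun h => h hq'

/-- As long as two vertices `x` and `y` of low degree are off the tour, Walker can move to a vertex
`v` such that `v` and its neighbours on the tour are joined to neither of them by Breaker. After
his answer one of `x` and `y` can still be inserted next to `v`, on one side or the other. -/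
lemma State.Finishing.step {s : State n} {k m : ℕ} (hk : 1000000 ≤ k) (hn : n ≤ 1000001 * k)
    (hm0 : 900000 * k ≤ m) (hm : m + 3 ≤ n) (hs : s.Finishing k m) :
    Force (fun t => t.Finishing k (m + 1)) s := by
  obtain ⟨X, u, hXm, hT, hlow⟩ := hs
  obtain ⟨x, hx, y, hy, hxy⟩ : ∃ x ∈ Xᶜ.erase u, ∃ y ∈ Xᶜ.erase u, x ≠ y := by
    refine Finset.one_lt_card.1 ?_
    have h1 := Finset.pred_card_le_card_erase (s := Xᶜ) (a := u)
    rw [Finset.card_compl, Fintype.card_fin, hXm] at h1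
    omega
  simp only [Finset.mem_erase, Finset.mem_compl] at hx hy
  have hdx := hlow x hx.2 hx.1
  have hdy := hlow y hy.2 hy.1
  have hheavy := s.card_heavy_le hk hn (hT.card_le.trans (by omega))
  obtain ⟨v, a, b, mid, hwalk, hv, ha, hb, hvis, hround⟩ :=
    hT.exists_hop (insert s.pos (s.nbrs s.pos) ∪ s.heavy k ∪ s.nbrs x ∪ s.nbrs y) (by simp)
      (fun z hz => by simp [hz]) (by
        have h1 := Finset.card_union_le (insert s.pos (s.nbrs s.pos)) (s.heavy k)
        have h2 := Finset.card_insert_le s.pos (s.nbrs s.pos)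
        have h3 : (s.nbrs s.pos).card ≤ 1002 * k := hT.deg_pos
        have h4 := Finset.card_union_le (insert s.pos (s.nbrs s.pos) ∪ s.heavy k) (s.nbrs x)
        have h5 := Finset.card_union_le
          (insert s.pos (s.nbrs s.pos) ∪ s.heavy k ∪ s.nbrs x) (s.nbrs y)
        unfold State.deg at hdx hdy
        omega)
  simp only [Finset.mem_union, not_or] at hv ha hb
  have hlight : ∀ z, z ∉ s.heavy k → s.deg z < 1000 * k := by
    intro z hz
    by_contra! hcon
    exact hz (by simpa [State.heavy] using hcon)
  refine Force.round v hwalk fun t hr => ?_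
  have hD := hround t hr
  have hmemX : ∀ z ∈ ({v, a, b} : Finset (Fin n)), z ∈ X := by
    intro z hz
    rw [← hvis]
    simp only [Finset.mem_insert, Finset.mem_singleton] at hz
    rcases hz with rfl | rfl | rfl <;> simp [visited]
  obtain ⟨z, hzX, hzu, hfree⟩ : ∃ z, z ∉ X ∧ z ≠ u ∧
      ∀ p ∈ ({v, a, b} : Finset (Fin n)), p ∉ t.nbrs z := by
    rcases hr.free_or (T := {v, a, b}) hxy (fun h => hx.2 (hmemX x h))
      (by simp [hv, ha, hb]) (by simp [hv, ha, hb]) with h | h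
    · exact ⟨x, hx.2, hx.1, h⟩
    · exact ⟨y, hy.2, hy.1, h⟩
  have hzv := hfree v (by simp)
  have hza := hfree a (by simp)
  have hzb := hfree b (by simp)
  rw [State.mem_nbrs] at hza hzb
  rw [State.mem_nbrs'] at hzv
  have hwalk' : t.CanWalkTo z := by
    rw [State.CanWalkTo, hr.pos_eq]
    exact ⟨fun h => hzX (h ▸ hmemX v (by simp)), hzv⟩
  refine Force.round z hwalk' fun t₁ hr₁ => ?_
  have hD₁ := hD.next (hvis.symm ▸ hzX) hr₁
  have hclose : t₁.CanClose a b := by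
    rw [State.CanClose, hr₁.pos_eq]
    exact hr₁.not_mem_or (fun h => hD.a_ne_b (Sym2.congr_right.1 h)) hza hzb
  have hX₁ : visited v a b mid [z] = insert z X := by rw [visited_cons, hvis]
  refine hD₁.force_close (A := 1000 * k + 1) (M := 3 * m + 2) (by simp) hclose ?_ ?_ ?_
    fun y t₂ hr₂ hT₂ => Force.done ⟨insert z X, u, ?_, ?_, fun p hp hpu => ?_⟩
  · exact (hr₁.deg_le a).trans
      (Nat.succ_le_succ ((hr.deg_le a).trans (hlight a ha.1.1.2)))
  · exact (hr₁.deg_le b).trans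
      (Nat.succ_le_succ ((hr.deg_le b).trans (hlight b hb.1.1.2)))
  · exact hr₁.card_le.trans
      (Nat.succ_le_succ (hr.card_le.trans (Nat.succ_le_succ hT.card_le)))
  · rw [Finset.card_insert_of_notMem hzX, hXm]
  · rw [hX₁] at hT₂
    exact ⟨hT₂.exists_tour, hT₂.pos_mem, hT₂.deg_pos.trans (by omega),
      hT₂.card_le.trans (by omega)⟩
  · rw [Finset.mem_insert, not_or] at hp
    have h1 := hlow p hp.2 hpu
    have h2 := hr.deg_le p
    have h3 := hr₁.deg_le p
    have h4 := hr₂.deg_le p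
    omega

lemma State.Finishing.force_cycle {k : ℕ} (hk : 1000000 ≤ k) (hn : n ≤ 1000001 * k) (r : ℕ) :
    ∀ (s : State n) (m : ℕ), m + (r + 2) = n → 900000 * k ≤ m → s.Finishing k m →
      Force (fun t => t.HasWalkerCycle (n - 2)) s := by
  induction r with
  | zero =>
    intro s m hmr hm hs
    obtain ⟨X, u, hXm, hT, -⟩ := hs
    obtain ⟨v, t, ht, hX⟩ := hT.exists_tour
    have hlen : X.card = t.length + 1 := by
      rw [← hX, List.toFinset_card_of_nodup ht.nodup]; simp
    have h1 := ht.hasWalkerCycle (by omega)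
    rw [show t.length + 1 = n - 2 by omega] at h1
    exact Force.done h1
  | succ r ih =>
    intro s m hmr hm hs
    exact (hs.step hk hn hm (by omega)).bind fun t ht =>
      ih t (m + 1) (by omega) (by omega) ht

/-! ### The first tour -/

/-- Walker stands at the end of a path along the vertices of `l`, the last of them coming first. -/
structure State.OnPath (s : State n) (l : List (Fin n)) : Prop where
  nodup : l.Nodup
  chain : l.IsChain s.WAdj
  head : l.head? = some s.pos

lemma State.OnPath.next {s t : State n} {l : List (Fin n)} {w : Fin n} (h : s.OnPath l)
    (hw : w ∉ l) (hr : Round s w t) : t.OnPath (w :: l) := by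
  refine ⟨List.nodup_cons.2 ⟨hw, h.nodup⟩, ?_, by simp [hr.pos_eq]⟩
  rw [List.isChain_cons]
  refine ⟨fun y hy => ?_, h.chain.imp fun _ _ h => hr.walkerEdges_subset h⟩
  rw [h.head] at hy
  obtain rfl : s.pos = y := by simpa using hy
  exact hr.wadj.symm

lemma State.OnPath.exists_next {s : State n} {l : List (Fin n)} (h : s.OnPath l)
    (S : Finset (Fin n)) (hcard : l.length + s.breakerEdges.card + S.card < n) :
    ∃ w ∉ l, w ∉ S ∧ s.CanWalkTo w := by
  have h1 : (l.toFinset ∪ s.nbrs s.pos ∪ S).card < n := by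
    have e1 := Finset.card_union_le (l.toFinset ∪ s.nbrs s.pos) S
    have e2 := Finset.card_union_le l.toFinset (s.nbrs s.pos)
    have e3 := List.toFinset_card_le l
    have e4 : (s.nbrs s.pos).card ≤ _ := s.deg_le_card s.pos
    omega
  obtain ⟨w, hw⟩ : ∃ w, w ∉ l.toFinset ∪ s.nbrs s.pos ∪ S := by
    by_contra! hcon
    rw [Finset.eq_univ_iff_forall.2 hcon, Finset.card_univ, Fintype.card_fin] at h1
    exact lt_irrefl _ h1
  simp only [Finset.mem_union, List.mem_toFinset, not_or, State.mem_nbrs] at hw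
  exact ⟨w, hw.1.1, hw.2, fun he => hw.1.1 (he ▸ List.mem_of_head? h.head), hw.1.2⟩

lemma force_path (j : ℕ) : ∀ (s : State n) (l : List (Fin n)), s.OnPath l →
    s.breakerEdges.card ≤ l.length → 2 * (l.length + j) < n →
    Force (fun t => ∃ l', l'.length = l.length + j ∧ t.OnPath l' ∧
      t.breakerEdges.card ≤ l'.length) s := by
  induction j with
  | zero => exact fun s l h1 h2 _ => Force.done ⟨l, rfl, h1, h2⟩
  | succ j ih =>
    intro s l h1 h2 h3
    obtain ⟨w, hw, -, hwalk⟩ := h1.exists_next ∅ (by simp; omega)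
    refine Force.round w hwalk fun t hr => ?_
    refine (ih t (w :: l) (h1.next hw hr) ?_ (by simp; omega)).mono ?_
    · exact hr.card_le.trans (Nat.succ_le_succ h2)
    · rintro t' ⟨l', h4, h5, h6⟩
      exact ⟨l', by simp at h4; omega, h5, h6⟩

lemma State.OnPath.isTour {s t : State n} {w e : Fin n} {l₁ l₂ : List (Fin n)}
    (h : s.OnPath (w :: (l₁ ++ e :: l₂))) (hr : Round s e t) : t.IsTour w (l₁ ++ [e]) := by
  have hpos : s.pos = w := by simpa using h.head.symm
  have hsub : (w :: (l₁ ++ [e])).Sublist (w :: (l₁ ++ e :: l₂)) := by simp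
  refine ⟨h.nodup.sublist hsub, ?_⟩
  have h1 := h.chain.imp fun _ _ h => hr.walkerEdges_subset h
  rw [← List.cons_append, List.isChain_split] at h1
  rw [show w :: (l₁ ++ [e]) ++ [w] = (w :: l₁) ++ e :: [w] by simp, List.isChain_split]
  exact ⟨h1.1, by simpa using hpos ▸ hr.wadj.symm⟩

lemma State.OnPath.force_growing {s : State n} {k : ℕ} {w e : Fin n} {l₁ l₂ : List (Fin n)}
    (h : s.OnPath (w :: (l₁ ++ e :: l₂))) (hk : 1000000 ≤ k) (hl : 3990 * k ≤ l₁.length)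
    (hwe : s(w, e) ∉ s.breakerEdges) (he : s.deg e ≤ 1000 * k)
    (hB : s.breakerEdges.card ≤ 4000 * k + 2) :
    Force (fun t => ∃ m, 3900 * k ≤ m ∧ m ≤ (w :: (l₁ ++ e :: l₂)).length ∧ t.Growing k m) s := by
  have hpos : s.pos = w := by simpa using h.head.symm
  have hne : w ≠ e := by
    have := h.nodup
    simp at this
    tauto
  refine Force.round e (by rw [State.CanWalkTo, hpos]; exact ⟨hne, hwe⟩) fun t hr => ?_
  have ht := h.isTour hr
  have hcard : (w :: (l₁ ++ [e])).toFinset.card = l₁.length + 2 := by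
    rw [List.toFinset_card_of_nodup ht.nodup]; simp
  have hBt := hr.card_le
  refine Force.done ⟨l₁.length + 2, by omega, by simp, (w :: (l₁ ++ [e])).toFinset, 0, 0, 5000 * k,
    hcard, ⟨⟨w, _, ht, rfl⟩, by simp [hr.pos_eq], ?_, by omega⟩, by simp, by simp, by omega,
    Or.inl fun z _ => (t.deg_le_card z).trans (by omega)⟩
  rw [hr.pos_eq]
  exact (hr.deg_le e).trans (by omega)

/-- Walker walks along a path and then returns to one of two vertices close to its beginning, both
of them of low degree in Breaker's graph. -/
lemma force_first_tour {k : ℕ} (hk : 1000000 ≤ k) (hn : n ≤ 1000001 * k) (hn' : 1000000 * k ≤ n)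
    {s : State n} (hB : s.breakerEdges.card ≤ 1) :
    Force (fun t => ∃ m, 3900 * k ≤ m ∧ m + 3 ≤ n ∧ t.Growing k m) s := by
  have h0 : s.OnPath [s.pos] := ⟨by simp, by simp, rfl⟩
  refine (force_path (4000 * k) s [s.pos] h0 (by simpa using hB) (by simp; omega)).bind ?_
  rintro t ⟨l, hlen, hl, hBt⟩
  simp at hlen
  have hheavy := t.card_heavy_le hk hn (by omega)
  obtain ⟨l₁, x, y, z, l₂, hdrop, hx, hy, -⟩ := exists_triple (l.drop (3990 * k))
    (hl.nodup.sublist (List.drop_sublist _ _)) (t.heavy k) (by rw [List.length_drop]; omega)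
  obtain ⟨p, rfl, hp⟩ : ∃ p, l = p ++ x :: y :: z :: l₂ ∧ 3990 * k ≤ p.length := by
    refine ⟨l.take (3990 * k) ++ l₁, ?_, ?_⟩
    · rw [List.append_assoc, ← hdrop, List.take_append_drop]
    · rw [List.length_append, List.length_take]; omega
  have hlight : ∀ z, z ∉ t.heavy k → t.deg z < 1000 * k := by
    intro z hz
    by_contra! hcon
    exact hz (by simpa [State.heavy] using hcon)
  have hdx := hlight x hx
  have hdy := hlight y hy
  obtain ⟨w, hw, hwS, hwalk⟩ := hl.exists_next (t.nbrs x ∪ t.nbrs y) (by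
    have h1 := Finset.card_union_le (t.nbrs x) (t.nbrs y)
    unfold State.deg at hdx hdy
    omega)
  rw [Finset.mem_union, not_or, State.mem_nbrs', State.mem_nbrs'] at hwS
  refine Force.round w hwalk fun t₁ hr => ?_
  have hl₁ := hl.next hw hr
  have hB₁ := hr.card_le
  have hxy : x ≠ y := by
    have := (List.nodup_append.1 hl.nodup).2.1
    simp at this
    tauto
  have hlen₁ : (w :: (p ++ x :: y :: z :: l₂)).length + 3 ≤ n := by
    rw [List.length_cons]; omega
  rcases hr.not_mem_or (fun h => hxy (Sym2.congr_right.1 h)) hwS.1 hwS.2 with h | h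
  · refine (hl₁.force_growing hk hp h ((hr.deg_le x).trans hdx) (by omega)).mono ?_
    rintro t₂ ⟨m, h1, h2, h3⟩
    exact ⟨m, h1, by omega, h3⟩
  · have e : p ++ x :: y :: z :: l₂ = (p ++ [x]) ++ y :: z :: l₂ := by simp
    rw [e] at hl₁ hlen₁
    refine (hl₁.force_growing hk (by simp; omega) h ((hr.deg_le y).trans hdy) (by omega)).mono ?_
    rintro t₂ ⟨m, h1, h2, h3⟩
    exact ⟨m, h1, by omega, h3⟩

theorem walkerCanCreateCycle (hn : 1000000000000 ≤ n) (v : Fin n) (first : Player) :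
    WalkerCanCreateCycle first v (n - 2) := by
  obtain ⟨k, hk, hn1, hn2⟩ : ∃ k, 1000000 ≤ k ∧ n ≤ 1000001 * k ∧ 1000000 * k ≤ n :=
    ⟨n / 1000000, by omega, by omega, by omega⟩
  refine walkerCanCreateCycle_of_force (fun s hs => ?_) first
  have h0 : s.breakerEdges.card ≤ 1 := by
    rcases hs with rfl | hs
    · simp [State.init]
    · obtain ⟨-, -, x, y, h | ⟨-, h⟩⟩ := hs.breaker_spec <;> simp [h, State.init]
  refine (force_first_tour hk hn1 hn2 h0).bind ?_
  rintro t ⟨m, h1, h2, h3⟩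
  refine (force_finishing hk hn1 hn2 (n - m) t m (by omega) h1 (by omega) h3).bind ?_
  rintro t' ⟨m', h4, h5, h6⟩
  exact h6.force_cycle hk hn1 (n - m' - 2) t' m' (by omega) h5

end WalkerBreaker

theorem theorem1p1 :
    ∃ n₀ : ℕ, ∀ n : ℕ, n₀ ≤ n → ∀ v : Fin n,
      (∀ first : WalkerBreaker.Player, WalkerBreaker.WalkerCanCreateCycle first v (n - 2)) ∧
      WalkerBreaker.BreakerCanPreventLongerCycles WalkerBreaker.Player.breaker v (n - 2) :=
  ⟨1000000000000, fun _ hn v => ⟨WalkerBreaker.walkerCanCreateCycle hn v,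
    WalkerBreaker.breakerCanPreventLongerCycles (le_trans (by norm_num) hn) v⟩⟩
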